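/- Let $a,b,c:\mathbb R\to\mathbb R$ be smooth and let $m:\mathbb R^2\to\mathbb C$ be smooth and compactly supported. Write $\widehat f(\xi)=(2\pi)^{-1/2}\int e^{-ix\xi}f(x)\,dx$ for the Fourier transform on $L^2(\mathbb R)$, $p(D)$ for the Fourier multiplier with symbol $p$, $\langle x\rangle=\sqrt{1+x^2}$, $\|f\|_{L^{2,s}}=\|\langle x\rangle^s f\|_{L^2}$, and let $T_m(f,g)$ be the function with Fourier transform $\xi\mapsto\int m(\xi-\eta,\eta)\widehat f(\xi-\eta)\widehat g(\eta)\,d\eta$. For $f,g\in L^2(\mathbb R)$ let $u,v,w:[0,\infty)\to L^2(\mathbb R)$ solve $$ i\partial_t u+a(D)u=T_m(v,w),\qquad i\partial_t v+b(D)v=0,\qquad i\partial_t w+c(D)w=0, $$ $$ u(0)=0,\qquad v(0)=f,\qquad w(0)=g, $$ where each equation is understood after Fourier transform in $x$, as an ordinary differential equation in $t\ge 0$ at almost every frequency $\xi$. Let $\phi(\xi,\eta)=-a(\xi+\eta)+b(\xi)+c(\eta)$ and $\Gamma=\{\phi=0\}$. Assume that on $\operatorname{Supp} m$ the function $\phi$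 vanishes to first order along $\Gamma$ (i.e. $\nabla\phi\ne0$ at every point of $\Gamma\cap\operatorname{Supp} m$, so that $\Gamma$ is a smooth curve near each such point) and that $\Gamma$ is non-characteristic there: at no point of $\Gamma\cap\operatorname{Supp} m$ is the tangent to $\Gamma$ parallel to $(1,0)$, $(0,1)$ or $(1,-1)$. Then the following bounds hold for all $t>0$ and all $f,g\in L^2(\mathbb R)$ (a bound being void when its right-hand side is infinite). 1. For every $2\le q<\infty$ and $0\le s<\frac14$ there is a constant $C$ depending only on $a,b,c,m,q,s$ such that $\|u(t)\|_{L^q}\le C\,t^{\frac{1-4s}{q}}\|f\|_{L^{2,s}}\|g\|_{L^{2,s}}$. 2. For every $2\le q<\infty$ and $s>\frac14$ there is a constant $C$ depending only on $a,b,c,m,q,s$ such that $\|u(t)\|_{L^q}\le C\,\langle\log t\rangle\|f\|_{L^{2,s}}\|g\|_{L^{2,s}}$. 3. For $q=\infty$ there is a constant $C$ depending only on $a,b,c,m$ such that $\|u(t)\|_{L^\infty}\le C\,\langle\log t\rangle\|f\|_{L^2}\|g\|_{L^2}$. -/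

import Mathlib

open MeasureTheory FourierTransform Complex
open scoped ContDiff ENNReal

noncomputable section

/-- The space `L²(ℝ; ℂ)`. -/
abbrev L2 : Type := Lp ℂ 2 (volume : Measure ℝ)

/-- The Fourier transform on `L²(ℝ)` in the angular frequency normalisation
`f̂(ξ) = (2π)^{-1/2} ∫ e^{-ixξ} f(x) dx`. Mathlib's `𝓕` is the unitary extension to `L²` of
`f ↦ ∫ e^{-2πixξ} f(x) dx`, so `f̂(ξ) = (2π)^{-1/2} (𝓕 f)(ξ / 2π)`. -/
def hat (f : L2) (ξ : ℝ) : ℂ :=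
  ((√(2 * Real.pi))⁻¹ : ℝ) * (𝓕 f : L2) (ξ / (2 * Real.pi))

/-- The Japanese bracket `⟨x⟩ = √(1 + x²)`. -/
def jap (x : ℝ) : ℝ := √(1 + x ^ 2)

/-- The weighted norm `‖f‖_{L^{2,s}} = ‖⟨x⟩^s f‖_{L²}`, with values in `[0, ∞]`. -/
def weightedNorm (s : ℝ) (f : L2) : ℝ≥0∞ :=
  eLpNorm (fun x : ℝ => ((jap x ^ s : ℝ) : ℂ) * f x) 2 volume

/-- The Fourier transform of the pseudo-product `T_m(f, g)`:
`ξ ↦ ∫ m(ξ - η, η) f̂(ξ - η) ĝ(η) dη`. -/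
def pseudoProductHat (m : ℝ × ℝ → ℂ) (f g : L2) (ξ : ℝ) : ℂ :=
  ∫ η : ℝ, m (ξ - η, η) * hat f (ξ - η) * hat g η

/-- `y : [0, ∞) → L²(ℝ)` solves the Cauchy problem `i ∂ₜ y + p(D) y = F`, `y(t = 0) = h`, the
source being given by its Fourier transform `Fhat t ξ`. Since `p` is an arbitrary symbol, the
equation is read on the Fourier side, frequency by frequency: some version `Y t ξ` of
`ŷ(t, ξ)` satisfies `i ∂ₜ Y + p(ξ) Y = F̂(t, ξ)` for almost every `ξ` and all `t ≥ 0`. -/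
structure SolvesCauchy (p : ℝ → ℝ) (Fhat : ℝ → ℝ → ℂ) (h : L2) (y : ℝ → L2) : Prop where
  initial : y 0 = h
  equation : ∃ Y : ℝ → ℝ → ℂ,
    (∀ t : ℝ, 0 ≤ t → Y t =ᵐ[volume] hat (y t)) ∧
    ∀ᵐ ξ : ℝ, ∀ t : ℝ, 0 ≤ t →
      ∃ Y' : ℂ, HasDerivWithinAt (fun τ : ℝ => Y τ ξ) Y' (Set.Ici 0) t ∧
        I * Y' + (p ξ : ℂ) * Y t ξ = Fhat t ξ

/-- `(u, v, w)` solves the system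
`i ∂ₜ u + a(D) u = T_m(v, w)`, `i ∂ₜ v + b(D) v = 0`, `i ∂ₜ w + c(D) w = 0`
with data `u(0) = 0`, `v(0) = f`, `w(0) = g`. -/
structure IsSolution (a b c : ℝ → ℝ) (m : ℝ × ℝ → ℂ) (f g : L2) (u v w : ℝ → L2) : Prop where
  eq_u : SolvesCauchy a (fun t => pseudoProductHat m (v t) (w t)) 0 u
  eq_v : SolvesCauchy b (fun _ _ => 0) f v
  eq_w : SolvesCauchy c (fun _ _ => 0) g w

/-- The phase `φ(ξ, η) = -a(ξ + η) + b(ξ) + c(η)`. -/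
def phase (a b c : ℝ → ℝ) (p : ℝ × ℝ) : ℝ := -a (p.1 + p.2) + b p.1 + c p.2

/-- The time resonant set `Γ = {φ = 0}`. -/
def resonantSet (φ : ℝ × ℝ → ℝ) : Set (ℝ × ℝ) := {p | φ p = 0}

/-- `φ` vanishes (exactly) to first order on `Γ = {φ = 0}` at the points of `K`: the differential
of `φ` does not vanish there. By the implicit function theorem, `Γ` is then a smooth curve near
each of these points, with tangent line `ker dφ`. -/
def VanishesToFirstOrderOn (φ : ℝ × ℝ → ℝ) (K : Set (ℝ × ℝ)) : Prop :=
  ∀ p ∈ resonantSet φ ∩ K, fderiv ℝ φ p ≠ 0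

/-- The characteristic directions of the frequency plane `(ξ, η)`: those of the lines on which one
of the three frequencies `η`, `ξ`, `ξ + η` is constant. -/
def characteristicDirections : Set (ℝ × ℝ) := {(1, 0), (0, 1), (1, -1)}

/-- The curve `Γ = {φ = 0}` is non-characteristic at the points of `K`: its tangent line `ker dφ`
contains no characteristic direction. -/
def NonCharacteristicOn (φ : ℝ × ℝ → ℝ) (K : Set (ℝ × ℝ)) : Prop :=
  ∀ p ∈ resonantSet φ ∩ K, ∀ d ∈ characteristicDirections, d ∉ (fderiv ℝ φ p).ker

end

open scoped NNReal

/-!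
By Duhamel's formula `û(t, ξ)` is, up to a factor of modulus one, the pseudo-product of `f̂` and `ĝ`
with symbol `m ∫₀ᵗ e^{iτφ} dτ`, and the oscillatory factor is bounded by `min(t, 2 / |φ|)`. Cutting
dyadically in `|φ| ∼ 2^{-j}`, down to the scale `1 / t`, gives pieces with symbols of size `2^j`
living on the strips `|φ| ≲ 2^{-j}` around `Γ`. Since `Γ` is non-characteristic, such a strip has
sections of length `O(2^{-j})` in each of the directions `ξ`, `η`, `ξ + η`, and Schur's test bounds
the Fourier transform of the `j`-th piece in `L¹`, hence the piece itself in `L^∞`, by `‖f‖₂ ‖g‖₂`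
uniformly in `j`: the thinness compensates the loss `2^j`.

In `L²` the data are split at the spatial scale `⟨x⟩ ∼ 2^j`. The inner parts are controlled in `L⁴`
after Fourier transform, by summing the bound on `‖f̂‖_{L⁴}` over dyadic shells, the outer parts in
`L²` by the weight; this is where `s = 1/4` is critical. Interpolating with the `L^∞` bound and
summing over `j` gives a geometric series if `s < 1/4`, and `O(log t)` equal terms in the two other
cases.
-/

noncomputable section

/-! ### The Fourier transform on `L¹ ∩ L²` -/

section FourierL1L2

variable {E F : Type*} [NormedAddCommGroup E] [InnerProductSpace ℝ E] [FiniteDimensional ℝ E]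
  [MeasurableSpace E] [BorelSpace E]

theorem enorm_fourierIntegral_le_lintegral [NormedAddCommGroup F] [NormedSpace ℂ F]
    {L : E →ₗ[ℝ] E →ₗ[ℝ] ℝ} {f : E → F} (hf : Integrable f) (ξ : E) :
    ‖VectorFourier.fourierIntegral 𝐞 volume L f ξ‖ₑ ≤ ∫⁻ x, ‖f x‖ₑ := by
  rw [← ofReal_integral_norm_eq_lintegral_enorm hf, ← ofReal_norm]
  exact ENNReal.ofReal_le_ofReal (VectorFourier.norm_fourierIntegral_le_integral_norm ..)

theorem ae_eq_fourierIntegral_of_forall_schwartz [NormedAddCommGroup F] [NormedSpace ℂ F]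
    [CompleteSpace F] {L : E →ₗ[ℝ] E →ₗ[ℝ] ℝ} (hL : Continuous fun p : E × E => L p.1 p.2)
    (hL' : L.flip = L) {f h : E → F} (hf : Integrable f) (hh : LocallyIntegrable h)
    (H : ∀ G : SchwartzMap E ℂ, ∫ x, VectorFourier.fourierIntegral 𝐞 volume L G x • f x
      = ∫ x, G x • h x) :
    h =ᵐ[volume] VectorFourier.fourierIntegral 𝐞 volume L f := by
  refine ae_eq_of_integral_contDiff_smul_eq hh
    (VectorFourier.fourierIntegral_continuous Real.continuous_fourierChar hL hf).locallyIntegrable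
    fun g hg hg_supp => ?_
  let G : SchwartzMap E ℂ :=
    (hg_supp.comp_left rfl : HasCompactSupport (ofRealCLM ∘ g)).toSchwartzMap (by fun_prop)
  have hG := VectorFourier.integral_fourierIntegral_smul_eq_flip (μ := volume) (ν := volume)
    (L := L) Real.continuous_fourierChar hL G.integrable hf
  rw [H, hL'] at hG
  have hsmul (k : E → F) (x : E) : G x • k x = g x • k x := Complex.coe_smul (g x) (k x)
  simpa only [hsmul] using hG

variable [NormedAddCommGroup F] [InnerProductSpace ℂ F] [CompleteSpace F]

theorem fourier_ae_eq_of_integrable (f : Lp F 2 (volume : Measure E)) (hf : Integrable f) :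
    (𝓕 f : Lp F 2 (volume : Measure E)) =ᵐ[volume] 𝓕 (f : E → F) := by
  refine ae_eq_fourierIntegral_of_forall_schwartz (L := innerₗ E) continuous_inner
    (flip_innerₗ E) hf ((Lp.memLp (𝓕 f)).locallyIntegrable one_le_two) fun G => ?_
  have h := congrArg (fun T => T G) (Lp.fourier_toTemperedDistribution_eq f)
  rwa [TemperedDistribution.fourier_apply, Lp.toTemperedDistribution_apply,
    Lp.toTemperedDistribution_apply] at h

theorem fourierInv_ae_eq_of_integrable (f : Lp F 2 (volume : Measure E)) (hf : Integrable f) :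
    (𝓕⁻ f : Lp F 2 (volume : Measure E)) =ᵐ[volume] 𝓕⁻ (f : E → F) := by
  refine ae_eq_fourierIntegral_of_forall_schwartz (L := -innerₗ E) continuous_inner.neg
    (by ext; simp [real_inner_comm]) hf ((Lp.memLp (𝓕⁻ f)).locallyIntegrable one_le_two) fun G => ?_
  have h := congrArg (fun T => T G) (Lp.fourierInv_toTemperedDistribution_eq f)
  rwa [TemperedDistribution.fourierInv_apply, Lp.toTemperedDistribution_apply,
    Lp.toTemperedDistribution_apply, SchwartzMap.fourierInv_coe] at h

theorem enorm_fourier_le_lintegral (f : Lp F 2 (volume : Measure E)) :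
    ∀ᵐ ξ, ‖(𝓕 f : Lp F 2 (volume : Measure E)) ξ‖ₑ ≤ ∫⁻ x, ‖f x‖ₑ := by
  by_cases hf : ∫⁻ x, ‖f x‖ₑ = ⊤
  · simp [hf]
  have hf : Integrable f := ⟨Lp.aestronglyMeasurable f, Ne.lt_top hf⟩
  filter_upwards [fourier_ae_eq_of_integrable f hf] with ξ hξ
  exact hξ ▸ enorm_fourierIntegral_le_lintegral hf ξ

theorem enorm_fourierInv_le_lintegral (f : Lp F 2 (volume : Measure E)) :
    ∀ᵐ x, ‖(𝓕⁻ f : Lp F 2 (volume : Measure E)) x‖ₑ ≤ ∫⁻ ξ, ‖f ξ‖ₑ := by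
  by_cases hf : ∫⁻ x, ‖f x‖ₑ = ⊤
  · simp [hf]
  have hf : Integrable f := ⟨Lp.aestronglyMeasurable f, Ne.lt_top hf⟩
  filter_upwards [fourierInv_ae_eq_of_integrable f hf] with x hx
  exact hx ▸ enorm_fourierIntegral_le_lintegral hf x

end FourierL1L2

/-! ### The Fourier transform in the angular normalisation -/

theorem enorm_ofReal_of_nonneg {r : ℝ} (hr : 0 ≤ r) : ‖(r : ℂ)‖ₑ = ENNReal.ofReal r := by
  rw [← ofReal_norm, norm_real, Real.norm_of_nonneg hr]

theorem eLpNorm_comp_smul {E F : Type*} [NormedAddCommGroup E] [NormedSpace ℝ E]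
    [FiniteDimensional ℝ E] [MeasurableSpace E] [BorelSpace E] [NormedAddCommGroup F]
    (μ : Measure E) [μ.IsAddHaarMeasure] {r : ℝ} (hr : r ≠ 0) {f : E → F}
    (hf : AEStronglyMeasurable f μ) {p : ℝ≥0∞} (hp : p ≠ ⊤) :
    eLpNorm (fun x => f (r • x)) p μ
      = ENNReal.ofReal |(r ^ Module.finrank ℝ E)⁻¹| ^ (1 / p).toReal * eLpNorm f p μ := by
  have h := eLpNorm_map_measure (p := p) (μ := μ) (f := (r • · : E → E)) (g := f)
    (by rw [Measure.map_addHaar_smul μ hr]; exact hf.smul_measure _) (by fun_prop)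
  rw [Measure.map_addHaar_smul μ hr, eLpNorm_smul_measure_of_ne_top hp] at h
  exact h.symm

theorem two_pi_inv_ne_zero : (2 * Real.pi)⁻¹ ≠ 0 := inv_ne_zero Real.two_pi_pos.ne'

theorem hat_apply (f : L2) (ξ : ℝ) :
    hat f ξ = ((√(2 * Real.pi))⁻¹ : ℝ) * (𝓕 f : L2) ((2 * Real.pi)⁻¹ • ξ) := by
  rw [hat, div_eq_inv_mul, smul_eq_mul]

theorem measurable_hat (f : L2) : Measurable (hat f) := by
  have := (Lp.stronglyMeasurable (𝓕 f : L2)).measurable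
  unfold hat
  fun_prop

theorem hat_ae_eq_of_fourier_ae_eq {f : L2} {h : ℝ → ℂ} (hh : (𝓕 f : L2) =ᵐ[volume] h) :
    hat f =ᵐ[volume] fun ξ => ((√(2 * Real.pi))⁻¹ : ℝ) * h ((2 * Real.pi)⁻¹ • ξ) := by
  filter_upwards [(Measure.quasiMeasurePreserving_smul volume two_pi_inv_ne_zero).ae_eq_comp hh]
    with ξ hξ
  rw [hat_apply]
  exact congrArg _ hξ

theorem hat_zero : hat 0 =ᵐ[volume] 0 := by
  have h : (𝓕 (0 : L2) : L2) =ᵐ[volume] 0 := by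
    rw [FourierTransform.fourier_zero]
    exact Lp.coeFn_zero ..
  filter_upwards [hat_ae_eq_of_fourier_ae_eq h] with ξ hξ
  simp [hξ]

theorem hat_add (f g : L2) : hat (f + g) =ᵐ[volume] hat f + hat g := by
  have h : (𝓕 (f + g) : L2) =ᵐ[volume] (𝓕 f : L2) + (𝓕 g : L2) := by
    rw [FourierTransform.fourier_add]
    exact Lp.coeFn_add ..
  filter_upwards [hat_ae_eq_of_fourier_ae_eq h] with ξ hξ
  simp only [hξ, Pi.add_apply, hat_apply, mul_add]

theorem hat_sum {ι : Type*} (s : Finset ι) (f : ι → L2) :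
    hat (∑ i ∈ s, f i) =ᵐ[volume] fun ξ => ∑ i ∈ s, hat (f i) ξ := by
  classical
  induction s using Finset.induction_on with
  | empty => simpa using! hat_zero
  | insert i s hi ih =>
    filter_upwards [hat_add (f i) (∑ i ∈ s, f i), ih] with ξ hadd hsum
    rw [Finset.sum_insert hi, hadd, Finset.sum_insert hi, Pi.add_apply, hsum]

theorem eLpNorm_fourier (f : L2) : eLpNorm (𝓕 f : L2) 2 volume = eLpNorm f 2 volume := by
  simpa only [Lp.norm_def, ENNReal.toReal_eq_toReal_iff' (Lp.eLpNorm_ne_top _)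
    (Lp.eLpNorm_ne_top _)] using Lp.norm_fourier_eq f

theorem eLpNorm_hat (f : L2) : eLpNorm (hat f) 2 volume = eLpNorm f 2 volume := by
  have hpi := Real.two_pi_pos
  have hconst : ‖(((√(2 * Real.pi))⁻¹ : ℝ) : ℂ)‖ₑ *
      ENNReal.ofReal |((2 * Real.pi)⁻¹ ^ 1)⁻¹| ^ (1 / (2 : ℝ≥0∞)).toReal = 1 := by
    rw [pow_one, inv_inv, abs_of_pos hpi, enorm_ofReal_of_nonneg (by positivity),
      ENNReal.ofReal_rpow_of_nonneg hpi.le (by positivity), ← ENNReal.ofReal_mul (by positivity),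
      ENNReal.toReal_div, ENNReal.toReal_one, ENNReal.toReal_ofNat, ← Real.sqrt_eq_rpow,
      inv_mul_cancel₀ (by positivity), ENNReal.ofReal_one]
  rw [show hat f = (((√(2 * Real.pi))⁻¹ : ℝ) : ℂ) • fun ξ : ℝ => (𝓕 f : L2) ((2 * Real.pi)⁻¹ • ξ)
    from funext (hat_apply f), eLpNorm_const_smul, eLpNorm_comp_smul volume two_pi_inv_ne_zero
    (Lp.aestronglyMeasurable _) ENNReal.ofNat_ne_top, Module.finrank_self, ← mul_assoc, hconst,
    one_mul, eLpNorm_fourier]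

theorem memLp_hat (f : L2) : MemLp (hat f) 2 volume :=
  ⟨(measurable_hat f).aestronglyMeasurable, by
    rw [eLpNorm_hat]; exact Lp.eLpNorm_lt_top f⟩

theorem hat_injective {f g : L2} (h : hat f =ᵐ[volume] hat g) : f = g := by
  have hzero : hat (f - g) =ᵐ[volume] 0 := by
    have hadd := hat_add (f - g) g
    rw [sub_add_cancel] at hadd
    filter_upwards [h, hadd] with ξ hfg hfξ
    rwa [hfξ, Pi.add_apply, add_eq_right] at hfg
  rw [← sub_eq_zero, Lp.eq_zero_iff_ae_eq_zero, ← eLpNorm_eq_zero_iff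
    (Lp.aestronglyMeasurable _) two_ne_zero, ← eLpNorm_hat, eLpNorm_congr_ae hzero, eLpNorm_zero]

theorem enorm_hat_le_lintegral (f : L2) : ∀ᵐ ξ : ℝ, ‖hat f ξ‖ₑ ≤ ∫⁻ x, ‖f x‖ₑ := by
  have hconst : ‖(((√(2 * Real.pi))⁻¹ : ℝ) : ℂ)‖ₑ ≤ 1 := by
    rw [enorm_ofReal_of_nonneg (by positivity), ENNReal.ofReal_le_one]
    exact inv_le_one_of_one_le₀ (Real.one_le_sqrt.2 (by linarith [Real.pi_gt_three]))
  filter_upwards [(Measure.quasiMeasurePreserving_smul volume two_pi_inv_ne_zero).ae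
    (enorm_fourier_le_lintegral f)] with ξ hξ
  rw [hat_apply, enorm_mul]
  exact (mul_le_mul' hconst hξ).trans_eq (one_mul _)

/-- The function whose inverse Fourier transform, in the normalisation of Mathlib, has `U` as its
transform in the normalisation of `hat`. -/
def unhat (U : ℝ → ℂ) (x : ℝ) : ℂ := (√(2 * Real.pi) : ℂ) * U ((2 * Real.pi) • x)

theorem eLpNorm_unhat {U : ℝ → ℂ} (hU : AEStronglyMeasurable U) {p : ℝ≥0∞} (hp : p ≠ ⊤) :
    eLpNorm (unhat U) p volume = ENNReal.ofReal (√(2 * Real.pi)) *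
      (ENNReal.ofReal (2 * Real.pi)⁻¹ ^ (1 / p).toReal * eLpNorm U p volume) := by
  have hpi := Real.two_pi_pos
  rw [show unhat U = (√(2 * Real.pi) : ℂ) • fun x : ℝ => U ((2 * Real.pi) • x) from rfl,
    eLpNorm_const_smul, eLpNorm_comp_smul volume hpi.ne' hU hp, Module.finrank_self, pow_one,
    enorm_ofReal_of_nonneg (by positivity), abs_of_pos (by positivity)]

theorem memLp_unhat {U : ℝ → ℂ} (hU : MemLp U 2 volume) : MemLp (unhat U) 2 volume := by
  refine ⟨(hU.1.comp_quasiMeasurePreserving (Measure.quasiMeasurePreserving_smul volume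
    Real.two_pi_pos.ne')).const_mul _, ?_⟩
  rw [eLpNorm_unhat hU.1 ENNReal.ofNat_ne_top]
  exact ENNReal.mul_lt_top ENNReal.ofReal_lt_top (ENNReal.mul_lt_top
    (ENNReal.rpow_lt_top_of_nonneg ENNReal.toReal_nonneg ENNReal.ofReal_ne_top) hU.2)

theorem lintegral_unhat_le {U : ℝ → ℂ} (hU : AEStronglyMeasurable U) :
    ∫⁻ x, ‖unhat U x‖ₑ ≤ ∫⁻ ξ, ‖U ξ‖ₑ := by
  have hpi := Real.two_pi_pos
  rw [← eLpNorm_one_eq_lintegral_enorm, ← eLpNorm_one_eq_lintegral_enorm,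
    eLpNorm_unhat hU ENNReal.one_ne_top, ← mul_assoc]
  refine mul_le_of_le_one_left' ?_
  rw [ENNReal.toReal_div, ENNReal.toReal_one, div_one, ENNReal.rpow_one,
    ← ENNReal.ofReal_mul (by positivity), ENNReal.ofReal_le_one, ← div_eq_mul_inv,
    div_le_one hpi, Real.sqrt_le_left hpi.le]
  nlinarith [Real.pi_gt_three]

theorem exists_hat_eq {U : ℝ → ℂ} (hU : MemLp U 2 volume) :
    ∃ y : L2, hat y =ᵐ[volume] U ∧ eLpNorm y ⊤ volume ≤ ∫⁻ ξ, ‖U ξ‖ₑ := by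
  set V : L2 := (memLp_unhat hU).toLp
  have hV : (V : ℝ → ℂ) =ᵐ[volume] unhat U := (memLp_unhat hU).coeFn_toLp
  refine ⟨𝓕⁻ V, ?_, ?_⟩
  · have hsqrt : (√(2 * Real.pi) : ℂ) ≠ 0 :=
      ofReal_ne_zero.2 (Real.sqrt_pos.2 Real.two_pi_pos).ne'
    have h : (𝓕 (𝓕⁻ V) : L2) =ᵐ[volume] unhat U := by rwa [fourier_fourierInv_eq]
    filter_upwards [hat_ae_eq_of_fourier_ae_eq h] with ξ hξ
    rw [hξ, unhat, smul_inv_smul₀ Real.two_pi_pos.ne', ofReal_inv, inv_mul_cancel_left₀ hsqrt]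
  · rw [eLpNorm_exponent_top]
    refine (essSup_le_of_ae_le _ (enorm_fourierInv_le_lintegral V)).trans ?_
    calc ∫⁻ ξ, ‖V ξ‖ₑ = ∫⁻ ξ, ‖unhat U ξ‖ₑ := lintegral_congr_ae (hV.fun_comp (‖·‖ₑ))
      _ ≤ ∫⁻ ξ, ‖U ξ‖ₑ := lintegral_unhat_le hU.1

/-! ### Thin neighbourhoods of a non-characteristic curve -/

section Slices

theorem volume_le_of_forall_sub_le {s : Set ℝ} {r : ℝ}
    (hs : ∀ x ∈ s, ∀ y ∈ s, x < y → y - x ≤ r) : volume s ≤ ENNReal.ofReal r := by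
  refine (Real.volume_le_diam s).trans (Metric.ediam_le fun x hx y hy => ?_)
  wlog hxy : x ≤ y generalizing x y
  · exact edist_comm x y ▸ this y hy x hx (le_of_not_ge hxy)
  obtain rfl | hlt := hxy.eq_or_lt
  · simp
  · rw [edist_comm, edist_dist, Real.dist_eq, abs_of_pos (sub_pos.2 hlt)]
    exact ENNReal.ofReal_le_ofReal (hs x hx y hy hlt)

variable {E : Type*} [NormedAddCommGroup E] [NormedSpace ℝ E] {φ : E → ℝ} {d : E}

theorem volume_slice_ball_le (hd : d ≠ 0) (x p : E) (r : ℝ) :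
    volume {τ : ℝ | p + τ • d ∈ Metric.ball x r} ≤ ENNReal.ofReal (2 * r / ‖d‖) := by
  refine volume_le_of_forall_sub_le fun τ₁ h₁ τ₂ h₂ hlt => ?_
  rw [le_div_iff₀ (norm_pos_iff.2 hd)]
  calc (τ₂ - τ₁) * ‖d‖ = dist (p + τ₂ • d) (p + τ₁ • d) := by
        rw [dist_add_left, dist_eq_norm, ← sub_smul, norm_smul,
          Real.norm_of_nonneg (sub_nonneg.2 hlt.le)]
    _ ≤ dist (p + τ₂ • d) x + dist (p + τ₁ • d) x := dist_triangle_right _ _ _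
    _ ≤ 2 * r := by
        have h₁ := Metric.mem_ball.1 h₁
        have h₂ := Metric.mem_ball.1 h₂
        linarith

theorem volume_slice_le_of_le_abs_fderiv (hφ : Differentiable ℝ φ) {S : Set E}
    (hS : Convex ℝ S) {l : ℝ} (hl : 0 < l) (h : ∀ p ∈ S, l ≤ |fderiv ℝ φ p d|) (p : E) (δ : ℝ) :
    volume {τ : ℝ | p + τ • d ∈ S ∧ |φ (p + τ • d)| ≤ δ} ≤
      ENNReal.ofReal (2 / l) * ENNReal.ofReal δ := by
  rw [← ENNReal.ofReal_mul (by positivity)]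
  refine volume_le_of_forall_sub_le fun τ₁ h₁ τ₂ h₂ hlt => ?_
  have hderiv (τ : ℝ) :
      HasDerivAt (fun τ : ℝ => φ (p + τ • d)) (fderiv ℝ φ (p + τ • d) d) τ := by
    have hline : HasDerivAt (fun τ : ℝ => p + τ • d) d τ := by
      simpa using ((hasDerivAt_id τ).smul_const d).const_add p
    exact (hφ _).hasFDerivAt.comp_hasDerivAt τ hline
  obtain ⟨z, hz, hslope⟩ := exists_hasDerivAt_eq_slope _ _ hlt
    (fun τ _ => (hderiv τ).continuousAt.continuousWithinAt) fun τ _ => hderiv τ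
  have hconn : ((fun τ : ℝ => p + τ • d) ⁻¹' S).OrdConnected :=
    ((hS.translate_preimage_right p).linear_preimage
      (LinearMap.toSpanSingleton ℝ E d)).ordConnected
  have hzl := h _ (hconn.out h₁.1 h₂.1 (Set.Ioo_subset_Icc_self hz))
  rw [hslope, abs_div, abs_of_pos (sub_pos.2 hlt), le_div_iff₀ (sub_pos.2 hlt)] at hzl
  rw [div_mul_eq_mul_div, le_div_iff₀ hl, mul_comm]
  calc l * (τ₂ - τ₁) ≤ |φ (p + τ₂ • d) - φ (p + τ₁ • d)| := hzl
    _ ≤ |φ (p + τ₂ • d)| + |φ (p + τ₁ • d)| := abs_sub _ _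
    _ ≤ 2 * δ := by linarith [h₁.2, h₂.2]

theorem volume_slice_le_of_le_abs (hd : d ≠ 0) {x : E} {r l : ℝ} (hr : 0 < r) (hl : 0 < l)
    (h : ∀ p ∈ Metric.ball x r, l ≤ |φ p|) (p : E) (δ : ℝ) :
    volume {τ : ℝ | p + τ • d ∈ Metric.ball x r ∧ |φ (p + τ • d)| ≤ δ}
      ≤ ENNReal.ofReal (2 * r / ‖d‖ / l) * ENNReal.ofReal δ := by
  rw [← ENNReal.ofReal_mul (by positivity)]
  by_cases hlδ : l ≤ δ
  · refine (measure_mono fun τ hτ => hτ.1).trans ((volume_slice_ball_le hd x p r).trans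
      (ENNReal.ofReal_le_ofReal ?_))
    rw [div_mul_eq_mul_div, le_div_iff₀ hl]
    gcongr
  · have hempty : {τ : ℝ | p + τ • d ∈ Metric.ball x r ∧ |φ (p + τ • d)| ≤ δ} = ∅ :=
      Set.eq_empty_of_forall_notMem fun τ hτ => hlδ ((h _ hτ.1).trans hτ.2)
    rw [hempty, measure_empty]
    exact zero_le

theorem exists_ball_volume_slice_le (hφ : ContDiff ℝ 1 φ) (hd : d ≠ 0) {x : E}
    (hx : φ x = 0 → fderiv ℝ φ x d ≠ 0) :
    ∃ r : ℝ, 0 < r ∧ ∃ C : ℝ≥0, ∀ (p : E) (δ : ℝ),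
      volume {τ : ℝ | p + τ • d ∈ Metric.ball x r ∧ |φ (p + τ • d)| ≤ δ}
        ≤ C * ENNReal.ofReal δ := by
  by_cases hx0 : φ x = 0
  · have hL : 0 < |fderiv ℝ φ x d| := abs_pos.2 (hx hx0)
    have hcont : Continuous fun y => |fderiv ℝ φ y d| :=
      ((hφ.continuous_fderiv one_ne_zero).clm_apply continuous_const).abs
    obtain ⟨r, hr, hball⟩ := Metric.eventually_nhds_iff_ball.1
      (hcont.continuousAt.eventually (lt_mem_nhds (half_lt_self hL)))
    exact ⟨r, hr, (2 / (|fderiv ℝ φ x d| / 2)).toNNReal, volume_slice_le_of_le_abs_fderiv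
      (hφ.differentiable one_ne_zero) (convex_ball x r) (half_pos hL) fun y hy => (hball y hy).le⟩
  · have hL : 0 < |φ x| := abs_pos.2 hx0
    obtain ⟨r, hr, hball⟩ := Metric.eventually_nhds_iff_ball.1
      (hφ.continuous.abs.continuousAt.eventually (lt_mem_nhds (half_lt_self hL)))
    exact ⟨r, hr, (2 * r / ‖d‖ / (|φ x| / 2)).toNNReal,
      volume_slice_le_of_le_abs hd hr (half_pos hL) fun y hy => (hball y hy).le⟩

theorem exists_volume_slice_le (hφ : ContDiff ℝ 1 φ) {K : Set E} (hK : IsCompact K) (hd : d ≠ 0)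
    (h : ∀ p ∈ K, φ p = 0 → fderiv ℝ φ p d ≠ 0) :
    ∃ C : ℝ≥0, ∀ (p : E) (δ : ℝ),
      volume {τ : ℝ | p + τ • d ∈ K ∧ |φ (p + τ • d)| ≤ δ} ≤ C * ENNReal.ofReal δ := by
  refine hK.induction_on (p := fun S => ∃ C : ℝ≥0, ∀ (p : E) (δ : ℝ),
    volume {τ : ℝ | p + τ • d ∈ S ∧ |φ (p + τ • d)| ≤ δ} ≤ C * ENNReal.ofReal δ) ?_ ?_ ?_ ?_
  · exact ⟨0, by simp⟩
  · rintro S T hST ⟨C, hT⟩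
    exact ⟨C, fun p δ => (measure_mono (Set.ofPred_subset_ofPred.2
      fun τ hτ => hτ.imp_left (@hST _))).trans (hT p δ)⟩
  · rintro S T ⟨C, hS⟩ ⟨C', hT⟩
    refine ⟨C + C', fun p δ => ?_⟩
    have hunion : {τ : ℝ | p + τ • d ∈ S ∪ T ∧ |φ (p + τ • d)| ≤ δ}
        = {τ : ℝ | p + τ • d ∈ S ∧ |φ (p + τ • d)| ≤ δ}
          ∪ {τ : ℝ | p + τ • d ∈ T ∧ |φ (p + τ • d)| ≤ δ} :=
      Set.ext fun τ => or_and_right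
    rw [hunion, ENNReal.coe_add, add_mul]
    exact (measure_union_le _ _).trans (add_le_add (hS p δ) (hT p δ))
  · intro x hx
    obtain ⟨r, hr, C, hball⟩ := exists_ball_volume_slice_le hφ hd (h x hx)
    exact ⟨Metric.ball x r, mem_nhdsWithin_of_mem_nhds (Metric.ball_mem_nhds x hr), C, hball⟩

end Slices

section CauchySchwarz

variable {α : Type*} [MeasurableSpace α] {μ : Measure α}

theorem sq_lintegral_mul_le {f g : α → ℝ≥0∞} (hf : AEMeasurable f μ) (hg : AEMeasurable g μ) :
    (∫⁻ x, f x * g x ∂μ) ^ 2 ≤ (∫⁻ x, f x ^ 2 ∂μ) * ∫⁻ x, g x ^ 2 ∂μ := by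
  have hsq (x : ℝ≥0∞) : (x ^ (1 / 2 : ℝ)) ^ 2 = x := by
    rw [← ENNReal.rpow_mul_natCast]
    norm_num
  have h := ENNReal.lintegral_mul_le_Lp_mul_Lq μ Real.HolderConjugate.two_two hf hg
  simp only [ENNReal.rpow_two] at h
  simpa only [Pi.mul_apply, mul_pow, hsq] using pow_le_pow_left' h 2

theorem sq_setLIntegral_le {s : Set α} {f : α → ℝ≥0∞} (hf : AEMeasurable f (μ.restrict s)) :
    (∫⁻ x in s, f x ∂μ) ^ 2 ≤ μ s * ∫⁻ x in s, f x ^ 2 ∂μ := by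
  simpa only [Pi.one_apply, one_mul, one_pow, lintegral_one, Measure.restrict_apply_univ] using
    sq_lintegral_mul_le (f := 1) aemeasurable_one hf

theorem setLIntegral_le_of_mul_lintegral_sq_le {s : Set α} {A : α → ℝ≥0∞} {σ X : ℝ≥0∞}
    (hs : μ s ≤ σ) (hA : Measurable A)
    (hX : σ * ∫⁻ x, A x ^ 2 ∂μ ≤ X ^ 2) : ∫⁻ x in s, A x ∂μ ≤ X := by
  refine (ENNReal.pow_le_pow_left_iff two_ne_zero).1 ((sq_setLIntegral_le hA.aemeasurable).trans
    (le_trans ?_ hX))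
  exact mul_le_mul' hs (setLIntegral_le_lintegral _ _)

end CauchySchwarz

/-! ### The Schur test -/

section Schur

variable {α β : Type*} [MeasurableSpace α] [MeasurableSpace β] {μ : Measure α} {ν : Measure β}
  [SFinite ν] {S : Set (α × β)} {F : α → ℝ≥0∞} {G : β → ℝ≥0∞} {σ c : ℝ≥0∞}

theorem setLIntegral_prod_mul_le_of_fst (hS : MeasurableSet S) (hF : Measurable F)
    (hG : Measurable G) (h : ∀ x, ∫⁻ y in {y | (x, y) ∈ S}, G y ∂ν ≤ c) :
    ∫⁻ p in S, F p.1 * G p.2 ∂μ.prod ν ≤ (∫⁻ x, F x ∂μ) * c := by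
  rw [← lintegral_indicator hS,
    lintegral_prod _ ((by fun_prop : Measurable _).indicator hS).aemeasurable,
    ← lintegral_mul_const _ hF]
  refine lintegral_mono fun x => ?_
  calc ∫⁻ y, S.indicator (fun p => F p.1 * G p.2) (x, y) ∂ν
      = ∫⁻ y in {y | (x, y) ∈ S}, F x * G y ∂ν :=
        lintegral_indicator (measurable_prodMk_left hS) _
    _ = F x * ∫⁻ y in {y | (x, y) ∈ S}, G y ∂ν := lintegral_const_mul _ hG
    _ ≤ F x * c := mul_le_mul' le_rfl (h x)

variable [SFinite μ]

theorem setLIntegral_prod_mul_le_of_snd (hS : MeasurableSet S) (hF : Measurable F)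
    (hG : Measurable G) (h : ∀ y, ∫⁻ x in {x | (x, y) ∈ S}, F x ∂μ ≤ c) :
    ∫⁻ p in S, F p.1 * G p.2 ∂μ.prod ν ≤ c * ∫⁻ y, G y ∂ν := by
  rw [← Measure.prod_swap, setLIntegral_map hS (by fun_prop) measurable_swap, mul_comm]
  simpa only [Prod.fst_swap, Prod.snd_swap, mul_comm] using
    setLIntegral_prod_mul_le_of_fst (measurable_swap hS) hG hF h

theorem sq_setLIntegral_prod_mul_le (hS : MeasurableSet S)
    (hfst : ∀ x, ν {y | (x, y) ∈ S} ≤ σ) (hsnd : ∀ y, μ {x | (x, y) ∈ S} ≤ σ)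
    (hF : Measurable F) (hG : Measurable G) :
    (∫⁻ p in S, F p.1 * G p.2 ∂μ.prod ν) ^ 2 ≤
      (σ * ∫⁻ x, F x ^ 2 ∂μ) * (σ * ∫⁻ y, G y ^ 2 ∂ν) := by
  refine (sq_lintegral_mul_le (by fun_prop) (by fun_prop)).trans (mul_le_mul' ?_ ?_)
  · simpa [mul_comm] using setLIntegral_prod_mul_le_of_fst (μ := μ) (ν := ν) (G := 1) (c := σ) hS
      (hF.pow_const 2) measurable_one (by simpa using hfst)
  · simpa using setLIntegral_prod_mul_le_of_snd (μ := μ) (ν := ν) (F := 1) (c := σ) hS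
      measurable_one (hG.pow_const 2) (by simpa using hsnd)

variable {A B : α → ℝ≥0∞} {A' B' : β → ℝ≥0∞} {X Y : ℝ≥0∞}

/-- The form `(F, G) ↦ ∬_S F ⊗ G` is bounded by `σ` on `L² × L²` and by `1` on `L¹ × L¹`; this is
the corresponding bound on sums `L² + L¹`. -/
theorem setLIntegral_prod_add_mul_add_le (hS : MeasurableSet S)
    (hfst : ∀ x, ν {y | (x, y) ∈ S} ≤ σ) (hsnd : ∀ y, μ {x | (x, y) ∈ S} ≤ σ)
    (hA : Measurable A) (hB : Measurable B) (hA' : Measurable A') (hB' : Measurable B')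
    (hAX : σ * ∫⁻ x, A x ^ 2 ∂μ ≤ X ^ 2) (hBX : ∫⁻ x, B x ∂μ ≤ X)
    (hAY : σ * ∫⁻ y, A' y ^ 2 ∂ν ≤ Y ^ 2) (hBY : ∫⁻ y, B' y ∂ν ≤ Y) :
    ∫⁻ p in S, (A p.1 + B p.1) * (A' p.2 + B' p.2) ∂μ.prod ν ≤ 4 * (X * Y) := by
  have hAA : ∫⁻ p in S, A p.1 * A' p.2 ∂μ.prod ν ≤ X * Y := by
    refine (ENNReal.pow_le_pow_left_iff two_ne_zero).1 ?_
    rw [mul_pow]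
    exact (sq_setLIntegral_prod_mul_le hS hfst hsnd hA hA').trans (mul_le_mul' hAX hAY)
  have hAB : ∫⁻ p in S, A p.1 * B' p.2 ∂μ.prod ν ≤ X * Y :=
    (setLIntegral_prod_mul_le_of_snd hS hA hB'
      fun y => setLIntegral_le_of_mul_lintegral_sq_le (hsnd y) hA hAX).trans (by gcongr)
  have hBA : ∫⁻ p in S, B p.1 * A' p.2 ∂μ.prod ν ≤ X * Y :=
    (setLIntegral_prod_mul_le_of_fst hS hB hA'
      fun x => setLIntegral_le_of_mul_lintegral_sq_le (hfst x) hA' hAY).trans (by gcongr)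
  have hBB : ∫⁻ p in S, B p.1 * B' p.2 ∂μ.prod ν ≤ X * Y :=
    (setLIntegral_prod_mul_le_of_fst hS hB hB'
      fun _ => (setLIntegral_le_lintegral _ _).trans hBY).trans (by gcongr)
  calc ∫⁻ p in S, (A p.1 + B p.1) * (A' p.2 + B' p.2) ∂μ.prod ν
      = (∫⁻ p in S, A p.1 * A' p.2 ∂μ.prod ν + ∫⁻ p in S, A p.1 * B' p.2 ∂μ.prod ν)
        + (∫⁻ p in S, B p.1 * A' p.2 ∂μ.prod ν + ∫⁻ p in S, B p.1 * B' p.2 ∂μ.prod ν) := by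
        rw [← lintegral_add_left (by fun_prop), ← lintegral_add_left (by fun_prop),
          ← lintegral_add_left (by fun_prop)]
        exact lintegral_congr fun p => by ring
    _ ≤ (X * Y + X * Y) + (X * Y + X * Y) := by gcongr
    _ = 4 * (X * Y) := by ring

end Schur

section ThinSlices

/-- The sections of the plane set `S` along the three characteristic directions, on which `ξ`, `η`
or `ξ + η` is constant, all have length at most `σ`. -/
structure HasThinSlices (S : Set (ℝ × ℝ)) (σ : ℝ≥0∞) : Prop where
  measurableSet : MeasurableSet S
  fst (ξ : ℝ) : volume {η : ℝ | (ξ, η) ∈ S} ≤ σ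
  snd (η : ℝ) : volume {ξ : ℝ | (ξ, η) ∈ S} ≤ σ
  diag (ξ : ℝ) : volume {η : ℝ | (ξ - η, η) ∈ S} ≤ σ

/-- The points of `K` at which the phase `φ` has size at most `δ`. -/
def resonantStrip (φ : ℝ × ℝ → ℝ) (K : Set (ℝ × ℝ)) (δ : ℝ) : Set (ℝ × ℝ) :=
  {p | p ∈ K ∧ |φ p| ≤ δ}

theorem exists_hasThinSlices_resonantStrip {φ : ℝ × ℝ → ℝ} (hφ : ContDiff ℝ 1 φ)
    {K : Set (ℝ × ℝ)} (hK : IsCompact K) (hΓ : NonCharacteristicOn φ K) :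
    ∃ D : ℝ≥0, ∀ δ : ℝ, HasThinSlices (resonantStrip φ K δ) (D * ENNReal.ofReal δ) := by
  have hslice (d : ℝ × ℝ) (hd : d ∈ characteristicDirections) (hd0 : d ≠ 0) :
      ∃ C : ℝ≥0, ∀ (p : ℝ × ℝ) (δ : ℝ),
        volume {τ : ℝ | p + τ • d ∈ resonantStrip φ K δ} ≤ C * ENNReal.ofReal δ :=
    exists_volume_slice_le hφ hK hd0 fun p hp hp0 => hΓ p ⟨hp0, hp⟩ d hd
  obtain ⟨C₁, h₁⟩ := hslice (0, 1) (by simp [characteristicDirections]) (by simp)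
  obtain ⟨C₂, h₂⟩ := hslice (1, 0) (by simp [characteristicDirections]) (by simp)
  obtain ⟨C₃, h₃⟩ := hslice (1, -1) (by simp [characteristicDirections]) (by simp)
  refine ⟨C₁ + C₂ + C₃, fun δ => ⟨hK.isClosed.measurableSet.inter
    (measurableSet_le hφ.continuous.abs.measurable measurable_const), fun ξ => ?_, fun η => ?_,
    fun ξ => ?_⟩⟩
  · calc volume {η : ℝ | (ξ, η) ∈ resonantStrip φ K δ} ≤ C₁ * ENNReal.ofReal δ := by
          simpa using h₁ (ξ, 0) δ
      _ ≤ _ := by gcongr; exact_mod_cast (le_self_add.trans le_self_add : C₁ ≤ C₁ + C₂ + C₃)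
  · calc volume {ξ : ℝ | (ξ, η) ∈ resonantStrip φ K δ} ≤ C₂ * ENNReal.ofReal δ := by
          simpa using h₂ (0, η) δ
      _ ≤ _ := by gcongr; exact_mod_cast (le_add_self.trans le_self_add : C₂ ≤ C₁ + C₂ + C₃)
  · calc volume {η : ℝ | (ξ - η, η) ∈ resonantStrip φ K δ}
        = volume ((fun η => -η) ⁻¹' {τ : ℝ | (ξ, 0) + τ • (1, -1) ∈ resonantStrip φ K δ}) := by
          simp [sub_eq_add_neg, Set.preimage]
      _ = volume {τ : ℝ | (ξ, 0) + τ • ((1, -1) : ℝ × ℝ) ∈ resonantStrip φ K δ} :=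
          Measure.measure_preimage_neg _ _
      _ ≤ C₃ * ENNReal.ofReal δ := h₃ (ξ, 0) δ
      _ ≤ _ := by gcongr; exact_mod_cast (le_add_self : C₃ ≤ C₁ + C₂ + C₃)

/-- The convolution of `F` and `G` with the integration restricted to `S`; it dominates the
transform of a pseudo-product whose symbol is supported in `S`. -/
def truncatedConv (S : Set (ℝ × ℝ)) (F G : ℝ → ℝ≥0∞) (ξ : ℝ) : ℝ≥0∞ :=
  ∫⁻ η in {η | (ξ - η, η) ∈ S}, F (ξ - η) * G η

variable {S : Set (ℝ × ℝ)} {σ : ℝ≥0∞} {F G : ℝ → ℝ≥0∞}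

theorem lintegral_lintegral_sub_eq {h : ℝ × ℝ → ℝ≥0∞} (hh : Measurable h) :
    ∫⁻ ξ : ℝ, ∫⁻ η : ℝ, h (ξ - η, η) = ∫⁻ p, h p := by
  rw [lintegral_lintegral_swap (by fun_prop), Measure.volume_eq_prod,
    lintegral_prod_symm _ hh.aemeasurable]
  exact lintegral_congr fun η => lintegral_sub_right_eq_self (fun ξ => h (ξ, η)) η

theorem truncatedConv_eq_lintegral_indicator (hS : MeasurableSet S) (F G : ℝ → ℝ≥0∞) (ξ : ℝ) :
    truncatedConv S F G ξ = ∫⁻ η, S.indicator (fun p => F p.1 * G p.2) (ξ - η, η) :=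
  (lintegral_indicator ((by fun_prop : Measurable fun η : ℝ => (ξ - η, η)) hS) _).symm

theorem measurable_truncatedConv (hS : MeasurableSet S) (hF : Measurable F) (hG : Measurable G) :
    Measurable (truncatedConv S F G) := by
  rw [funext (truncatedConv_eq_lintegral_indicator hS F G)]
  have hm : Measurable (S.indicator fun p : ℝ × ℝ => F p.1 * G p.2) :=
    Measurable.indicator (by fun_prop) hS
  exact Measurable.lintegral_prod_right' (f := fun q : ℝ × ℝ =>
    S.indicator (fun p : ℝ × ℝ => F p.1 * G p.2) (q.1 - q.2, q.2)) (hm.comp (by fun_prop))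

theorem lintegral_truncatedConv (hS : MeasurableSet S) (hF : Measurable F) (hG : Measurable G) :
    ∫⁻ ξ, truncatedConv S F G ξ = ∫⁻ p in S, F p.1 * G p.2 := by
  simp only [truncatedConv_eq_lintegral_indicator hS]
  rw [lintegral_lintegral_sub_eq (Measurable.indicator (by fun_prop) hS), lintegral_indicator hS]

theorem HasThinSlices.sq_lintegral_truncatedConv_le (hS : HasThinSlices S σ) (hF : Measurable F)
    (hG : Measurable G) :
    (∫⁻ ξ, truncatedConv S F G ξ) ^ 2 ≤ (σ * ∫⁻ ξ, F ξ ^ 2) * (σ * ∫⁻ η, G η ^ 2) := by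
  rw [lintegral_truncatedConv hS.measurableSet hF hG]
  exact sq_setLIntegral_prod_mul_le hS.measurableSet hS.fst hS.snd hF hG

theorem HasThinSlices.lintegral_sq_truncatedConv_le (hS : HasThinSlices S σ) (hF : Measurable F)
    (hG : Measurable G) :
    ∫⁻ ξ, truncatedConv S F G ξ ^ 2 ≤ σ * ∫⁻ p in S, F p.1 ^ 2 * G p.2 ^ 2 := by
  rw [← lintegral_truncatedConv hS.measurableSet (hF.pow_const 2) (hG.pow_const 2),
    ← lintegral_const_mul _
      (measurable_truncatedConv hS.measurableSet (hF.pow_const 2) (hG.pow_const 2))]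
  refine lintegral_mono fun ξ => (sq_setLIntegral_le (by fun_prop)).trans ?_
  simp only [mul_pow]
  exact mul_le_mul' (hS.diag ξ) le_rfl

theorem HasThinSlices.lintegral_sq_truncatedConv_le_of_sq_le_add (hS : HasThinSlices S σ)
    {A B A' B' : ℝ → ℝ≥0∞} {X Y : ℝ≥0∞} (hF : Measurable F) (hG : Measurable G)
    (hA : Measurable A) (hB : Measurable B) (hA' : Measurable A') (hB' : Measurable B')
    (hFAB : ∀ᵐ ξ, F ξ ^ 2 ≤ A ξ + B ξ) (hGAB : ∀ᵐ η, G η ^ 2 ≤ A' η + B' η)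
    (hAX : σ * ∫⁻ ξ, A ξ ^ 2 ≤ X ^ 2) (hBX : ∫⁻ ξ, B ξ ≤ X)
    (hAY : σ * ∫⁻ η, A' η ^ 2 ≤ Y ^ 2) (hBY : ∫⁻ η, B' η ≤ Y) :
    ∫⁻ ξ, truncatedConv S F G ξ ^ 2 ≤ σ * (4 * (X * Y)) := by
  refine (hS.lintegral_sq_truncatedConv_le hF hG).trans (mul_le_mul' le_rfl (le_trans ?_
    (setLIntegral_prod_add_mul_add_le hS.measurableSet hS.fst hS.snd hA hB hA' hB'
      hAX hBX hAY hBY)))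
  refine lintegral_mono_ae (ae_restrict_of_ae ?_)
  filter_upwards [Measure.quasiMeasurePreserving_fst.ae hFAB,
    Measure.quasiMeasurePreserving_snd.ae hGAB] with p hF hG
  exact mul_le_mul' hF hG

end ThinSlices

/-! ### The Duhamel formula -/

theorem norm_cexp_I_mul_mul (τ y : ℝ) : ‖cexp (I * τ * y)‖ = 1 := by
  rw [mul_assoc, ← ofReal_mul, norm_exp_I_mul_ofReal]

theorem duhamel {p : ℝ} {Y F : ℝ → ℂ} {t : ℝ} (ht : 0 ≤ t)
    (hY : ∀ τ : ℝ, 0 ≤ τ → ∃ Y' : ℂ, HasDerivWithinAt Y Y' (Set.Ici 0) τ ∧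
      I * Y' + (p : ℂ) * Y τ = F τ)
    (hF : IntervalIntegrable (fun τ : ℝ => cexp (-(I * τ * p)) * F τ) volume 0 t) :
    Y t = cexp (I * t * p) * (Y 0 - I * ∫ τ in (0 : ℝ)..t, cexp (-(I * τ * p)) * F τ) := by
  have hexp (τ : ℝ) : HasDerivAt (fun τ : ℝ => cexp (-(I * τ * p)))
      (cexp (-(I * τ * p)) * (-(I * p))) τ := by
    have hlin : HasDerivAt (fun τ : ℝ => -(I * (τ : ℂ) * p)) (-(I * p)) τ := by
      simpa using! (((hasDerivAt_id τ).ofReal_comp.const_mul I).mul_const (p : ℂ)).neg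
    exact hlin.cexp
  have hcont : ContinuousOn (fun τ : ℝ => cexp (-(I * τ * p)) * Y τ) (Set.Icc 0 t) := by
    intro τ hτ
    obtain ⟨Y', hY', -⟩ := hY τ hτ.1
    exact (hexp τ).continuousAt.continuousWithinAt.mul
      (hY'.continuousWithinAt.mono Set.Icc_subset_Ici_self)
  have hder : ∀ τ ∈ Set.Ioo 0 t, HasDerivAt (fun τ : ℝ => cexp (-(I * τ * p)) * Y τ)
      (-I * (cexp (-(I * τ * p)) * F τ)) τ := by
    intro τ hτ
    obtain ⟨Y', hY', hode⟩ := hY τ hτ.1.le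
    convert! (hexp τ).mul (hY'.hasDerivAt (Ici_mem_nhds hτ.1)) using 1
    rw [← hode]
    linear_combination (-cexp (-(I * τ * p)) * Y') * I_mul_I
  have hftc := intervalIntegral.integral_eq_sub_of_hasDerivAt_of_le ht hcont hder (hF.const_mul _)
  have hzero : cexp (-(I * ((0 : ℝ) : ℂ) * p)) = 1 := by simp
  have hinv : cexp (I * t * p) * cexp (-(I * t * p)) = 1 := by rw [← Complex.exp_add]; simp
  rw [intervalIntegral.integral_const_mul, hzero] at hftc
  linear_combination (-cexp (I * t * p)) * hftc - Y t * hinv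

theorem hat_eq_of_solvesCauchy_zero {p : ℝ → ℝ} {h : L2} {y : ℝ → L2}
    (hy : SolvesCauchy p (fun _ _ => 0) h y) {t : ℝ} (ht : 0 ≤ t) :
    hat (y t) =ᵐ[volume] fun ξ => cexp (I * t * p ξ) * hat h ξ := by
  obtain ⟨Y, hY, hode⟩ := hy.equation
  filter_upwards [hY t ht, hY 0 le_rfl, hode] with ξ hYt hY0 hξ
  simpa [hYt, hY0, hy.initial] using duhamel ht hξ (by simp)

theorem integrable_hat_mul_hat (f g : L2) (ξ : ℝ) :
    Integrable fun η : ℝ => hat f (ξ - η) * hat g η :=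
  ((memLp_hat f).comp_measurePreserving
    (volume.measurePreserving_sub_left ξ)).integrable_mul (memLp_hat g)

/-- The oscillatory factor `∫₀ᵗ e^{iτy} dτ` produced by integrating a mode of frequency `y`
over `[0, t]`. -/
def oscIntegral (t y : ℝ) : ℂ := ∫ τ in (0 : ℝ)..t, cexp (I * τ * y)

/-- The Fourier transform of the pseudo-product of `f` and `g` with symbol
`m(ξ, η) k(φ(ξ, η))`. -/
def bilinearHat (m : ℝ × ℝ → ℂ) (φ : ℝ × ℝ → ℝ) (k : ℝ → ℂ) (f g : L2) (ξ : ℝ) : ℂ :=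
  ∫ η : ℝ, m (ξ - η, η) * k (φ (ξ - η, η)) * (hat f (ξ - η) * hat g η)

section Duhamel

variable {a b c : ℝ → ℝ} {m : ℝ × ℝ → ℂ} {M : ℝ} {f g : L2} {u v w : ℝ → L2}

theorem cexp_mul_pseudoProductHat (hv : SolvesCauchy b (fun _ _ => 0) f v)
    (hw : SolvesCauchy c (fun _ _ => 0) g w) {τ : ℝ} (hτ : 0 ≤ τ) (ξ : ℝ) :
    cexp (-(I * τ * a ξ)) * pseudoProductHat m (v τ) (w τ) ξ =
      bilinearHat m (phase a b c) (fun y => cexp (I * τ * y)) f g ξ := by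
  rw [pseudoProductHat, ← integral_const_mul]
  refine integral_congr_ae ?_
  filter_upwards [(volume.measurePreserving_sub_left ξ).quasiMeasurePreserving.ae_eq_comp
    (hat_eq_of_solvesCauchy_zero hv hτ), hat_eq_of_solvesCauchy_zero hw hτ] with η hvη hwη
  simp only [Function.comp] at hvη
  have hexp : cexp (I * τ * phase a b c (ξ - η, η)) =
      cexp (-(I * τ * a ξ)) * cexp (I * τ * b (ξ - η)) * cexp (I * τ * c η) := by
    rw [← Complex.exp_add, ← Complex.exp_add, phase, sub_add_cancel]
    push_cast
    ring_nf
  rw [hvη, hwη, hexp]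
  ring

theorem integrable_duhamel_integrand {φ : ℝ × ℝ → ℝ} {ξ : ℝ}
    (hφ : Measurable fun η => φ (ξ - η, η)) (hm : Measurable m) (hM : ∀ p, ‖m p‖ ≤ M) (t : ℝ) :
    Integrable (Function.uncurry fun τ η : ℝ => m (ξ - η, η) * cexp (I * τ * φ (ξ - η, η)) *
      (hat f (ξ - η) * hat g η)) ((volume.restrict (Set.uIoc 0 t)).prod volume) := by
  have hdata : Integrable (fun z : ℝ × ℝ => (1 : ℂ) * (hat f (ξ - z.2) * hat g z.2))
      ((volume.restrict (Set.uIoc 0 t)).prod volume) :=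
    Integrable.mul_prod (f := fun _ : ℝ => (1 : ℂ))
      (integrable_const_iff.2 (Or.inr (by constructor; simp))) (integrable_hat_mul_hat f g ξ)
  simp only [one_mul] at hdata
  refine hdata.bdd_mul (c := M) (Measurable.aestronglyMeasurable ?_)
    (Filter.Eventually.of_forall fun z => ?_)
  · have hφ' : Measurable fun z : ℝ × ℝ => (φ (ξ - z.2, z.2) : ℂ) :=
      measurable_ofReal.comp (hφ.comp measurable_snd)
    exact (hm.comp (by fun_prop)).mul
      ((measurable_const.mul (measurable_ofReal.comp measurable_fst)).mul hφ').cexp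
  · rw [norm_mul, norm_cexp_I_mul_mul, mul_one]
    exact hM _

theorem intervalIntegral_bilinearHat {φ : ℝ × ℝ → ℝ} {ξ : ℝ}
    (hφ : Measurable fun η => φ (ξ - η, η)) (hm : Measurable m) (hM : ∀ p, ‖m p‖ ≤ M) (t : ℝ) :
    ∫ τ in (0 : ℝ)..t, bilinearHat m φ (fun y => cexp (I * τ * y)) f g ξ =
      bilinearHat m φ (oscIntegral t) f g ξ := by
  simp only [bilinearHat]
  rw [intervalIntegral_integral_swap (integrable_duhamel_integrand hφ hm hM t)]
  simp only [oscIntegral, intervalIntegral.integral_mul_const, intervalIntegral.integral_const_mul]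

theorem hat_eq_of_isSolution (hb : Measurable b) (hc : Measurable c) (hm : Measurable m)
    (hM : ∀ p, ‖m p‖ ≤ M) (h : IsSolution a b c m f g u v w) {t : ℝ} (ht : 0 ≤ t) :
    hat (u t) =ᵐ[volume] fun ξ => cexp (I * t * a ξ) *
      (-I * bilinearHat m (phase a b c) (oscIntegral t) f g ξ) := by
  obtain ⟨Y, hY, hode⟩ := h.eq_u.equation
  filter_upwards [hY t ht, hY 0 le_rfl, hat_zero, hode] with ξ hYt hY0 hzero hξ
  have hφ : Measurable fun η : ℝ => phase a b c (ξ - η, η) := by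
    simp only [phase, sub_add_cancel]
    fun_prop
  have hsource : Set.EqOn
      (fun τ : ℝ => bilinearHat m (phase a b c) (fun y => cexp (I * τ * y)) f g ξ)
      (fun τ : ℝ => cexp (-(I * τ * a ξ)) * pseudoProductHat m (v τ) (w τ) ξ) (Set.uIcc 0 t) := by
    intro τ hτ
    rw [Set.uIcc_of_le ht] at hτ
    exact (cexp_mul_pseudoProductHat h.eq_v h.eq_w hτ.1 ξ).symm
  have hint : IntervalIntegrable
      (fun τ : ℝ => bilinearHat m (phase a b c) (fun y => cexp (I * τ * y)) f g ξ) volume 0 t := by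
    rw [intervalIntegrable_iff]
    exact (integrable_duhamel_integrand hφ hm hM t).integral_prod_left
  have hduhamel := duhamel ht hξ (hint.congr fun τ hτ => hsource (Set.uIoc_subset_uIcc hτ))
  rw [← intervalIntegral.integral_congr hsource, intervalIntegral_bilinearHat hφ hm hM,
    hYt, hY0, h.eq_u.initial, hzero, Pi.zero_apply, zero_sub, ← neg_mul] at hduhamel
  exact hduhamel

end Duhamel

theorem norm_oscIntegral_le {t : ℝ} (ht : 0 ≤ t) (y : ℝ) : ‖oscIntegral t y‖ ≤ t := by
  simpa [oscIntegral, abs_of_nonneg ht] using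
    intervalIntegral.norm_integral_le_of_norm_le_const (a := 0) (b := t) (C := 1)
      fun τ _ => (norm_cexp_I_mul_mul τ y).le

theorem norm_oscIntegral_le_div {y : ℝ} (hy : y ≠ 0) (t : ℝ) : ‖oscIntegral t y‖ ≤ 2 / |y| := by
  have hIy : (y : ℂ) * I ≠ 0 := mul_ne_zero (ofReal_ne_zero.2 hy) I_ne_zero
  have hosc : oscIntegral t y = (cexp (I * t * y) - cexp (I * (0 : ℝ) * y)) / (y * I) := by
    rw [oscIntegral, show (I * t * y : ℂ) = y * I * t by ring,
      show (I * (0 : ℝ) * y : ℂ) = y * I * (0 : ℝ) by ring, ← integral_exp_mul_complex hIy]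
    simp only [mul_comm (y : ℂ) I, mul_right_comm I]
  rw [hosc, norm_div, norm_mul, norm_I, mul_one, norm_real, Real.norm_eq_abs]
  gcongr
  refine (norm_sub_le _ _).trans ?_
  rw [norm_cexp_I_mul_mul, norm_cexp_I_mul_mul, one_add_one_eq_two]

theorem continuous_oscIntegral (t : ℝ) : Continuous (oscIntegral t) :=
  intervalIntegral.continuous_parametric_intervalIntegral_of_continuous' (by fun_prop) 0 t

/-! ### Dyadic decomposition of the data -/

theorem eLpNorm_pow_eq_lintegral {α E : Type*} [MeasurableSpace α] [NormedAddCommGroup E]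
    {μ : Measure α} (f : α → E) {n : ℕ} (hn : n ≠ 0) :
    eLpNorm f n μ ^ n = ∫⁻ x, ‖f x‖ₑ ^ n ∂μ := by
  simpa using eLpNorm_nnreal_pow_eq_lintegral (μ := μ) (f := f) (p := (n : ℝ≥0)) (by simpa using hn)

theorem one_le_jap (x : ℝ) : 1 ≤ jap x := by
  rw [jap, Real.one_le_sqrt]
  nlinarith [sq_nonneg x]

theorem abs_le_jap (x : ℝ) : |x| ≤ jap x :=
  Real.abs_le_sqrt (by linarith)

theorem measurable_jap : Measurable jap := by
  unfold jap
  fun_prop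

/-- The part of `f` living on the measurable set `E`. -/
def cut {E : Set ℝ} (hE : MeasurableSet E) (f : L2) : L2 :=
  ((Lp.memLp f).indicator hE).toLp

section Cut

variable {E : Set ℝ} (hE : MeasurableSet E) (f : L2)

theorem coeFn_cut : cut hE f =ᵐ[volume] E.indicator f :=
  MemLp.coeFn_toLp _

theorem eLpNorm_cut_le_weightedNorm {s R : ℝ} (hs : 0 ≤ s) (hR : 0 < R) (h : ∀ x ∈ E, R ≤ jap x) :
    eLpNorm (cut hE f) 2 volume ≤ ENNReal.ofReal (R ^ (-s)) * weightedNorm s f := by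
  rw [eLpNorm_congr_ae (coeFn_cut hE f)]
  refine eLpNorm_le_mul_eLpNorm_of_ae_le_mul (Filter.Eventually.of_forall fun x => ?_) 2
  by_cases hx : x ∈ E
  · have hjap : 0 < jap x := hR.trans_le (h x hx)
    rw [Set.indicator_of_mem hx, norm_mul, norm_real, Real.norm_of_nonneg (by positivity),
      ← mul_assoc]
    refine le_mul_of_one_le_left (norm_nonneg _) ?_
    rw [Real.rpow_neg hR.le, ← div_eq_inv_mul, one_le_div (by positivity)]
    exact Real.rpow_le_rpow hR.le (h x hx) hs
  · rw [Set.indicator_of_notMem hx, norm_zero]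
    positivity

theorem sq_lintegral_cut_le :
    (∫⁻ x, ‖cut hE f x‖ₑ) ^ 2 ≤ volume E * eLpNorm (cut hE f) 2 volume ^ 2 := by
  have hsupp : ∫⁻ x, ‖cut hE f x‖ₑ = ∫⁻ x in E, ‖cut hE f x‖ₑ := by
    rw [← lintegral_indicator hE]
    refine lintegral_congr_ae ?_
    filter_upwards [coeFn_cut hE f] with x hx
    by_cases h : x ∈ E <;> simp [hx, h]
  have hsq : eLpNorm (cut hE f) 2 volume ^ 2 = ∫⁻ x, ‖cut hE f x‖ₑ ^ 2 :=
    eLpNorm_pow_eq_lintegral _ two_ne_zero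
  rw [hsupp, hsq]
  refine (sq_setLIntegral_le (Lp.aestronglyMeasurable _).enorm.restrict).trans ?_
  exact mul_le_mul' le_rfl (setLIntegral_le_lintegral _ _)

theorem eLpNorm_hat_cut_pow_le :
    eLpNorm (hat (cut hE f)) 4 volume ^ 4 ≤ volume E * eLpNorm (cut hE f) 2 volume ^ 4 := by
  have hfour : eLpNorm (hat (cut hE f)) 4 volume ^ 4 = ∫⁻ ξ, ‖hat (cut hE f) ξ‖ₑ ^ 4 :=
    eLpNorm_pow_eq_lintegral _ four_ne_zero
  have htwo : eLpNorm (hat (cut hE f)) 2 volume ^ 2 = ∫⁻ ξ, ‖hat (cut hE f) ξ‖ₑ ^ 2 :=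
    eLpNorm_pow_eq_lintegral _ two_ne_zero
  rw [hfour]
  calc ∫⁻ ξ, ‖hat (cut hE f) ξ‖ₑ ^ 4
      ≤ ∫⁻ ξ, (∫⁻ x, ‖cut hE f x‖ₑ) ^ 2 * ‖hat (cut hE f) ξ‖ₑ ^ 2 := by
        refine lintegral_mono_ae ?_
        filter_upwards [enorm_hat_le_lintegral (cut hE f)] with ξ hξ
        calc ‖hat (cut hE f) ξ‖ₑ ^ 4
            = ‖hat (cut hE f) ξ‖ₑ ^ 2 * ‖hat (cut hE f) ξ‖ₑ ^ 2 := by ring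
          _ ≤ _ := by gcongr
    _ = (∫⁻ x, ‖cut hE f x‖ₑ) ^ 2 * eLpNorm (cut hE f) 2 volume ^ 2 := by
        rw [lintegral_const_mul _ ((measurable_hat _).enorm.pow_const 2), ← htwo, eLpNorm_hat]
    _ ≤ (volume E * eLpNorm (cut hE f) 2 volume ^ 2) * eLpNorm (cut hE f) 2 volume ^ 2 :=
        mul_le_mul' (sq_lintegral_cut_le hE f) le_rfl
    _ = volume E * eLpNorm (cut hE f) 2 volume ^ 4 := by ring

end Cut

theorem weightedNorm_zero (f : L2) : weightedNorm 0 f = eLpNorm f 2 volume := by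
  simp [weightedNorm]

theorem eLpNorm_le_weightedNorm (f : L2) {s : ℝ} (hs : 0 ≤ s) :
    eLpNorm f 2 volume ≤ weightedNorm s f := by
  have hcut : cut MeasurableSet.univ f =ᵐ[volume] f := by
    simpa using! coeFn_cut MeasurableSet.univ f
  simpa [eLpNorm_congr_ae hcut] using
    eLpNorm_cut_le_weightedNorm MeasurableSet.univ f hs one_pos fun x _ => one_le_jap x

theorem sum_indicator_diff_add_indicator {α β : Type*} [AddCommGroup β] {E : ℕ → Set α}
    (hE : Antitone E) (f : α → β) (n : ℕ) :
    ∑ j ∈ Finset.range n, (E j \ E (j + 1)).indicator f + (E n).indicator f =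
      (E 0).indicator f := by
  simp only [fun j => Set.indicator_sdiff (hE (Nat.le_succ j)) f,
    Finset.sum_range_sub' fun j => (E j).indicator f, sub_add_cancel]

/-- The region `{⟨x⟩ ≥ 2ⁿ}`; the successive differences of these regions are the dyadic shells
in which the data are decomposed. -/
def outerRegion (n : ℕ) : Set ℝ := {x | 2 ^ n ≤ jap x}

theorem measurableSet_outerRegion (n : ℕ) : MeasurableSet (outerRegion n) :=
  measurableSet_le measurable_const measurable_jap

theorem antitone_outerRegion : Antitone outerRegion :=
  fun _ _ hjn _ hx => (pow_le_pow_right₀ one_le_two hjn : (2 : ℝ) ^ _ ≤ 2 ^ _).trans hx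

theorem outerRegion_zero : outerRegion 0 = Set.univ :=
  Set.eq_univ_of_forall fun x => by simpa [outerRegion] using one_le_jap x

theorem measurableSet_shell (n : ℕ) : MeasurableSet (outerRegion n \ outerRegion (n + 1)) :=
  (measurableSet_outerRegion n).diff (measurableSet_outerRegion (n + 1))

theorem volume_shell_le (n : ℕ) :
    volume (outerRegion n \ outerRegion (n + 1)) ≤ 2 ^ 4 * 2 ^ n := by
  have hball : outerRegion n \ outerRegion (n + 1) ⊆ Metric.ball 0 (2 ^ (n + 1)) := by
    rintro x ⟨-, hx⟩
    rw [mem_ball_zero_iff, Real.norm_eq_abs]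
    exact (abs_le_jap x).trans_lt (not_le.1 hx)
  refine (measure_mono hball).trans ?_
  rw [Real.volume_ball, ← pow_succ', ENNReal.ofReal_pow zero_le_two, ENNReal.ofReal_ofNat,
    ← pow_add]
  exact pow_le_pow_right₀ one_le_two (by lia)

theorem sum_cut_shell_add_cut_outerRegion (f : L2) (n : ℕ) :
    ∑ j ∈ Finset.range n, cut (measurableSet_shell j) f + cut (measurableSet_outerRegion n) f =
      f := by
  have hae : ∀ᵐ x, ∀ j, cut (measurableSet_shell j) f x =
      (outerRegion j \ outerRegion (j + 1)).indicator f x :=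
    ae_all_iff.2 fun j => coeFn_cut (measurableSet_shell j) f
  refine Lp.ext ?_
  filter_upwards [hae, coeFn_cut (measurableSet_outerRegion n) f, Lp.coeFn_add
    (∑ j ∈ Finset.range n, cut (measurableSet_shell j) f) (cut (measurableSet_outerRegion n) f),
    Lp.coeFn_finsetSum (Finset.range n) fun j => cut (measurableSet_shell j) f]
    with x hshell houter hadd hsum
  have := congrFun (sum_indicator_diff_add_indicator antitone_outerRegion f n) x
  simp only [outerRegion_zero, Set.indicator_univ, Pi.add_apply, Finset.sum_apply] at this
  rw [hadd, Pi.add_apply, hsum, houter, ← this]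
  simp only [Finset.sum_apply, hshell]

theorem two_rpow_add (x y : ℝ) : (2 : ℝ≥0∞) ^ (x + y) = 2 ^ x * 2 ^ y :=
  ENNReal.rpow_add x y two_ne_zero ENNReal.ofNat_ne_top

theorem two_rpow_pow (x : ℝ) (n : ℕ) : ((2 : ℝ≥0∞) ^ x) ^ n = 2 ^ (n * x) := by
  rw [← ENNReal.rpow_natCast, ← ENNReal.rpow_mul, mul_comm]

theorem ofReal_two_rpow (x : ℝ) : ENNReal.ofReal (2 ^ x) = 2 ^ x := by
  rw [← ENNReal.ofReal_rpow_of_pos two_pos, ENNReal.ofReal_ofNat]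

theorem geom_sum_le {x : ℝ} (hx : 0 ≤ x) (hx1 : x ≠ 1) (n : ℕ) :
    ∑ j ∈ Finset.range n, x ^ j ≤ |x - 1|⁻¹ * max x 1 ^ n := by
  rw [geom_sum_eq hx1, div_eq_inv_mul]
  rcases hx1.lt_or_gt with hlt | hgt
  · rw [abs_of_neg (sub_neg.2 hlt), max_eq_right hlt.le, one_pow, ← neg_sub 1 x,
      ← neg_sub 1 (x ^ n), inv_neg, neg_mul_neg, neg_neg]
    gcongr
    linarith [pow_nonneg hx n]
  · rw [abs_of_pos (sub_pos.2 hgt), max_eq_left hgt.le]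
    gcongr
    linarith

theorem exists_sum_two_rpow_le {e : ℝ} (he : e ≠ 0) :
    ∃ C : ℝ≥0, ∀ n : ℕ,
      ∑ j ∈ Finset.range n, (2 : ℝ≥0∞) ^ (e * j) ≤ C * 2 ^ (max e 0 * n) := by
  have hpow (e : ℝ) (j : ℕ) : (2 : ℝ≥0∞) ^ (e * j) = ENNReal.ofReal ((2 ^ e) ^ j) := by
    rw [← ofReal_two_rpow, Real.rpow_mul zero_le_two, Real.rpow_natCast]
  have hmax : (2 : ℝ) ^ max e 0 = max (2 ^ e) 1 := by
    rw [(Real.monotone_rpow_of_base_ge_one one_le_two).map_max, Real.rpow_zero]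
  have hne : (2 : ℝ) ^ e ≠ 1 := by
    simpa using (Real.rpow_right_inj two_pos (by norm_num : (2 : ℝ) ≠ 1)).not.2 he
  refine ⟨|(2 : ℝ) ^ e - 1|⁻¹.toNNReal, fun n => ?_⟩
  simp only [hpow, hmax]
  rw [← ENNReal.ofReal_sum_of_nonneg fun j _ => by positivity, ENNReal.ofNNReal_toNNReal,
    ← ENNReal.ofReal_mul (by positivity)]
  exact ENNReal.ofReal_le_ofReal (geom_sum_le (by positivity) hne n)

/-- The exponent `κ` for which a function of `L^{2,s}` cut off to `{⟨x⟩ < R}` has a Fourier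
transform of size `O(R^κ)` in `L⁴` (for `s ≠ 1/4`). -/
def growthExponent (s : ℝ) : ℝ := max (1 / 4 - s) 0

theorem growthExponent_nonneg (s : ℝ) : 0 ≤ growthExponent s := le_max_right _ _

theorem growthExponent_of_lt {s : ℝ} (h : s < 1 / 4) : growthExponent s = 1 / 4 - s :=
  max_eq_left (sub_pos.2 h).le

theorem growthExponent_of_gt {s : ℝ} (h : 1 / 4 < s) : growthExponent s = 0 :=
  max_eq_right (sub_neg.2 h).le

theorem neg_le_growthExponent_sub (s : ℝ) : -s ≤ growthExponent s - 1 / 4 := by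
  rw [growthExponent]
  linarith [le_max_left (1 / 4 - s) 0]

section DataSplitting

variable {s : ℝ}

theorem eLpNorm_cut_le_of_subset_outerRegion {E : Set ℝ} (hE : MeasurableSet E) (f : L2)
    (hs : 0 ≤ s) {n : ℕ} (h : E ⊆ outerRegion n) :
    eLpNorm (cut hE f) 2 volume ≤ 2 ^ (-s * n) * weightedNorm s f := by
  refine (eLpNorm_cut_le_weightedNorm hE f hs (pow_pos two_pos n) h).trans_eq ?_
  rw [← Real.rpow_natCast, ← Real.rpow_mul zero_le_two, ofReal_two_rpow, mul_comm (n : ℝ)]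

theorem eLpNorm_hat_cut_shell_le (hs : 0 ≤ s) (f : L2) (n : ℕ) :
    eLpNorm (hat (cut (measurableSet_shell n) f)) 4 volume ≤
      2 * 2 ^ ((1 / 4 - s) * n) * weightedNorm s f := by
  refine (ENNReal.pow_le_pow_left_iff four_ne_zero).1
    ((eLpNorm_hat_cut_pow_le (measurableSet_shell n) f).trans ?_)
  refine (mul_le_mul' (volume_shell_le n) (pow_le_pow_left' (eLpNorm_cut_le_of_subset_outerRegion
    (measurableSet_shell n) f hs Set.sdiff_subset) 4)).trans_eq ?_
  have hexp : (4 : ℕ) * ((1 / 4 - s) * n) = n + (4 : ℕ) * (-s * n) := by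
    push_cast
    ring
  rw [mul_pow, mul_pow, mul_pow, two_rpow_pow, two_rpow_pow, hexp, two_rpow_add,
    ENNReal.rpow_natCast]
  ring

theorem exists_split (hs : 0 ≤ s) (hs4 : s ≠ 1 / 4) :
    ∃ C : ℝ≥0, ∀ (f : L2) (n : ℕ), ∃ fl fh : L2, fl + fh = f ∧
      eLpNorm (hat fl) 4 volume ≤ C * 2 ^ (growthExponent s * n) * weightedNorm s f ∧
      eLpNorm (hat fh) 2 volume ≤ 2 ^ ((growthExponent s - 1 / 4) * n) * weightedNorm s f := by
  obtain ⟨C, hC⟩ := exists_sum_two_rpow_le (sub_ne_zero.2 hs4.symm)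
  refine ⟨2 * C, fun f n => ⟨_, _, sum_cut_shell_add_cut_outerRegion f n, ?_, ?_⟩⟩
  · calc eLpNorm (hat (∑ j ∈ Finset.range n, cut (measurableSet_shell j) f)) 4 volume
        = eLpNorm (∑ j ∈ Finset.range n, hat (cut (measurableSet_shell j) f)) 4 volume := by
          refine eLpNorm_congr_ae ((hat_sum _ _).trans (ae_of_all _ fun ξ => ?_))
          rw [Finset.sum_apply]
      _ ≤ ∑ j ∈ Finset.range n, eLpNorm (hat (cut (measurableSet_shell j) f)) 4 volume :=
          eLpNorm_sum_le (fun j _ => (measurable_hat _).aestronglyMeasurable) (by norm_num)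
      _ ≤ ∑ j ∈ Finset.range n, 2 * 2 ^ ((1 / 4 - s) * j) * weightedNorm s f :=
          Finset.sum_le_sum fun j _ => eLpNorm_hat_cut_shell_le hs f j
      _ = 2 * (∑ j ∈ Finset.range n, 2 ^ ((1 / 4 - s) * j)) * weightedNorm s f := by
          rw [Finset.mul_sum, Finset.sum_mul]
      _ ≤ 2 * (C * 2 ^ (growthExponent s * n)) * weightedNorm s f := by
          gcongr
          exact hC n
      _ = _ := by
          push_cast
          ring
  · rw [eLpNorm_hat]
    refine (eLpNorm_cut_le_of_subset_outerRegion _ f hs subset_rfl).trans ?_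
    gcongr
    · exact one_le_two
    · exact neg_le_growthExponent_sub s

theorem lintegral_sq_two_mul_sq_le {F : ℝ → ℂ} (hF : Measurable F) {C : ℝ≥0} {κ : ℝ} {n : ℕ}
    {W : ℝ≥0∞} (h : eLpNorm F 4 volume ≤ C * 2 ^ (κ * n) * W) :
    ∫⁻ ξ, (2 * ‖F ξ‖ₑ ^ 2) ^ 2 ≤ 2 ^ n * (2 * C ^ 2 * 2 ^ ((2 * κ - 1 / 2) * n) * W ^ 2) ^ 2 := by
  have hfour : eLpNorm F 4 volume ^ 4 = ∫⁻ ξ, ‖F ξ‖ₑ ^ 4 := eLpNorm_pow_eq_lintegral _ four_ne_zero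
  have hexp : (4 : ℕ) * (κ * n) = n + (2 : ℕ) * ((2 * κ - 1 / 2) * n) := by
    push_cast
    ring
  calc ∫⁻ ξ, (2 * ‖F ξ‖ₑ ^ 2) ^ 2
      = 4 * eLpNorm F 4 volume ^ 4 := by
        rw [hfour, ← lintegral_const_mul _ (hF.enorm.pow_const 4)]
        exact lintegral_congr fun ξ => by ring
    _ ≤ 4 * (C * 2 ^ (κ * n) * W) ^ 4 := by gcongr
    _ = _ := by
        simp only [mul_pow, two_rpow_pow, hexp, two_rpow_add, ENNReal.rpow_natCast]
        ring

theorem lintegral_two_mul_sq_le {F : ℝ → ℂ} (hF : Measurable F) {κ : ℝ} {n : ℕ} {W : ℝ≥0∞}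
    (h : eLpNorm F 2 volume ≤ 2 ^ ((κ - 1 / 4) * n) * W) :
    ∫⁻ ξ, 2 * ‖F ξ‖ₑ ^ 2 ≤ 2 * 2 ^ ((2 * κ - 1 / 2) * n) * W ^ 2 := by
  have htwo : eLpNorm F 2 volume ^ 2 = ∫⁻ ξ, ‖F ξ‖ₑ ^ 2 := eLpNorm_pow_eq_lintegral _ two_ne_zero
  have hexp : (2 : ℕ) * ((κ - 1 / 4) * n) = (2 * κ - 1 / 2) * n := by
    push_cast
    ring
  rw [lintegral_const_mul _ (hF.enorm.pow_const 2), ← htwo]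
  refine (mul_le_mul' le_rfl (pow_le_pow_left' h 2)).trans_eq ?_
  rw [mul_pow, two_rpow_pow, hexp, mul_assoc]

theorem exists_sq_split (hs : 0 ≤ s) (hs4 : s ≠ 1 / 4) :
    ∃ C : ℝ≥0, ∀ (f : L2) (n : ℕ), ∃ A B : ℝ → ℝ≥0∞, Measurable A ∧ Measurable B ∧
      (∀ᵐ ξ : ℝ, ‖hat f ξ‖ₑ ^ 2 ≤ A ξ + B ξ) ∧
      ∫⁻ ξ, A ξ ^ 2 ≤
        2 ^ n * (C * 2 ^ ((2 * growthExponent s - 1 / 2) * n) * weightedNorm s f ^ 2) ^ 2 ∧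
      ∫⁻ ξ, B ξ ≤ C * 2 ^ ((2 * growthExponent s - 1 / 2) * n) * weightedNorm s f ^ 2 := by
  obtain ⟨C, hC⟩ := exists_split hs hs4
  refine ⟨2 * C ^ 2 + 2, fun f n => ?_⟩
  obtain ⟨fl, fh, hf, hl, hh⟩ := hC f n
  have hml := measurable_hat fl
  have hmh := measurable_hat fh
  refine ⟨fun ξ => 2 * ‖hat fl ξ‖ₑ ^ 2, fun ξ => 2 * ‖hat fh ξ‖ₑ ^ 2, by fun_prop, by fun_prop,
    ?_, (lintegral_sq_two_mul_sq_le hml hl).trans ?_, (lintegral_two_mul_sq_le hmh hh).trans ?_⟩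
  · filter_upwards [hat_add fl fh] with ξ hξ
    rw [← hf, hξ, Pi.add_apply, ← mul_add]
    refine (pow_le_pow_left' (enorm_add_le _ _) 2).trans ?_
    simpa [show (2 : ℝ) - 1 = 1 by norm_num] using
      ENNReal.rpow_add_le_mul_rpow_add_rpow ‖hat fl ξ‖ₑ ‖hat fh ξ‖ₑ one_le_two
  · push_cast
    gcongr
    exact le_self_add
  · push_cast
    gcongr
    exact le_add_self

end DataSplitting

/-! ### Bilinear estimates at a dyadic scale -/

theorem eLpNorm_le_eLpNorm_rpow_mul_eLpNorm_top_rpow {α E : Type*} [MeasurableSpace α]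
    [NormedAddCommGroup E] {μ : Measure α} {f : α → E} (hf : AEStronglyMeasurable f μ)
    {p q : ℝ≥0∞} (hp0 : p ≠ 0) (hp : p ≠ ⊤) (hpq : p ≤ q) :
    eLpNorm f q μ ≤ eLpNorm f p μ ^ (p / q).toReal * eLpNorm f ⊤ μ ^ (1 - (p / q).toReal) := by
  rcases eq_or_ne q ⊤ with rfl | hq
  · simp
  have hq0 : q ≠ 0 := (pos_of_ne_zero hp0 |>.trans_le hpq).ne'
  have hp0' : 0 < p.toReal := ENNReal.toReal_pos hp0 hp
  have hq0' : 0 < q.toReal := ENNReal.toReal_pos hq0 hq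
  have hpq' : 0 ≤ q.toReal - p.toReal := sub_nonneg.2 (ENNReal.toReal_mono hq hpq)
  have hint : ∫⁻ x, ‖f x‖ₑ ^ q.toReal ∂μ ≤
      (∫⁻ x, ‖f x‖ₑ ^ p.toReal ∂μ) * eLpNorm f ⊤ μ ^ (q.toReal - p.toReal) := by
    rw [← lintegral_mul_const'' _ (hf.enorm.pow_const _)]
    refine lintegral_mono_ae ?_
    filter_upwards [enorm_ae_le_eLpNormEssSup f μ] with x hx
    nth_rw 1 [← add_sub_cancel p.toReal q.toReal]
    rw [ENNReal.rpow_add_of_nonneg _ _ hp0'.le hpq', eLpNorm_exponent_top]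
    gcongr
  rw [eLpNorm_eq_lintegral_rpow_enorm_toReal hq0 hq, eLpNorm_eq_lintegral_rpow_enorm_toReal hp0 hp,
    ENNReal.toReal_div]
  refine (ENNReal.rpow_le_rpow hint (by positivity)).trans_eq ?_
  rw [ENNReal.mul_rpow_of_nonneg _ _ (by positivity), ← ENNReal.rpow_mul, ← ENNReal.rpow_mul]
  congr 2 <;> field_simp

section TruncatedConvolution

variable {S : Set (ℝ × ℝ)}

theorem lintegral_truncatedConv_hat_le {σ : ℝ≥0∞} (hS : HasThinSlices S σ) (f g : L2) :
    ∫⁻ ξ, truncatedConv S (fun ξ => ‖hat f ξ‖ₑ) (fun η => ‖hat g η‖ₑ) ξ ≤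
      σ * (eLpNorm f 2 volume * eLpNorm g 2 volume) := by
  have hsq (h : L2) : ∫⁻ ξ, ‖hat h ξ‖ₑ ^ 2 = eLpNorm h 2 volume ^ 2 := by
    rw [← eLpNorm_hat]
    exact (eLpNorm_pow_eq_lintegral (hat h) two_ne_zero).symm
  refine (ENNReal.pow_le_pow_left_iff two_ne_zero).1 ((hS.sq_lintegral_truncatedConv_le
    (measurable_hat f).enorm (measurable_hat g).enorm).trans_eq ?_)
  rw [hsq, hsq]
  ring

theorem div_two_pow_mul_le {x Y : ℝ≥0∞} {n : ℕ} (σ : ℝ≥0) (h : x ≤ 2 ^ n * Y ^ 2) :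
    σ / 2 ^ n * x ≤ ((σ + 1) * Y) ^ 2 := by
  calc σ / 2 ^ n * x ≤ σ / 2 ^ n * (2 ^ n * Y ^ 2) := by gcongr
    _ = σ * Y ^ 2 := by
        rw [← mul_assoc, ENNReal.div_mul_cancel (by simp) (by simp)]
    _ ≤ (σ + 1) ^ 2 * Y ^ 2 := by
        gcongr
        exact le_self_add.trans (le_self_pow₀ le_add_self two_ne_zero)
    _ = ((σ + 1) * Y) ^ 2 := (mul_pow _ _ 2).symm

theorem exists_lintegral_sq_truncatedConv_hat_le {s : ℝ} (hs : 0 ≤ s) (hs4 : s ≠ 1 / 4)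
    (σ : ℝ≥0) :
    ∃ C : ℝ≥0, ∀ (n : ℕ) (S : Set (ℝ × ℝ)), HasThinSlices S (σ / 2 ^ n) → ∀ f g : L2,
      ∫⁻ ξ, truncatedConv S (fun ξ => ‖hat f ξ‖ₑ) (fun η => ‖hat g η‖ₑ) ξ ^ 2 ≤
        (C * 2 ^ (2 * growthExponent s * n) / 2 ^ n *
          (weightedNorm s f * weightedNorm s g)) ^ 2 := by
  obtain ⟨C, hC⟩ := exists_sq_split hs hs4
  set κ := growthExponent s
  refine ⟨2 * (σ + 1) ^ 2 * C, fun n S hS f g => ?_⟩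
  obtain ⟨A, B, hA, hB, hAB, hA4, hB2⟩ := hC f n
  obtain ⟨A', B', hA', hB', hAB', hA4', hB2'⟩ := hC g n
  set P : ℝ≥0∞ := C * 2 ^ ((2 * κ - 1 / 2) * n) with hP
  have hone : (1 : ℝ≥0∞) ≤ σ + 1 := le_add_self
  refine (hS.lintegral_sq_truncatedConv_le_of_sq_le_add (measurable_hat f).enorm
    (measurable_hat g).enorm hA hB hA' hB' hAB hAB' (div_two_pow_mul_le σ hA4)
    (hB2.trans (le_mul_of_one_le_left' hone)) (div_two_pow_mul_le σ hA4')
    (hB2'.trans (le_mul_of_one_le_left' hone))).trans ?_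
  have hP2 : P ^ 2 = C ^ 2 * (2 ^ (2 * κ * n)) ^ 2 / 2 ^ n := by
    have hexp : (2 : ℕ) * ((2 * κ - 1 / 2) * n) = (2 : ℕ) * (2 * κ * n) + -(n : ℝ) := by
      push_cast
      ring
    rw [hP, mul_pow, two_rpow_pow, two_rpow_pow, hexp, two_rpow_add, ENNReal.rpow_neg,
      ENNReal.rpow_natCast, ← mul_assoc, div_eq_mul_inv]
  calc σ / 2 ^ n * (4 * ((σ + 1) * (P * weightedNorm s f ^ 2) *
        ((σ + 1) * (P * weightedNorm s g ^ 2))))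
      = σ * (P ^ 2 / 2 ^ n * (2 * (σ + 1) * (weightedNorm s f * weightedNorm s g)) ^ 2) := by
        simp only [div_eq_mul_inv]
        ring
    _ ≤ (σ + 1) ^ 2 *
        (P ^ 2 / 2 ^ n * (2 * (σ + 1) * (weightedNorm s f * weightedNorm s g)) ^ 2) := by
        gcongr
        exact le_self_add.trans (le_self_pow₀ hone two_ne_zero)
    _ = _ := by
        rw [hP2]
        push_cast
        simp only [div_eq_mul_inv]
        ring

end TruncatedConvolution

section DyadicPiece

variable {m : ℝ × ℝ → ℂ} {φ : ℝ × ℝ → ℝ} {k : ℝ → ℂ}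

theorem aestronglyMeasurable_bilinearHat (hm : Measurable m) (hφ : Measurable φ)
    (hk : Measurable k) (f g : L2) : AEStronglyMeasurable (bilinearHat m φ k f g) volume := by
  have hf := measurable_hat f
  have hg := measurable_hat g
  have hp : Measurable fun z : ℝ × ℝ => (z.1 - z.2, z.2) := by fun_prop
  have hmeas : Measurable fun z : ℝ × ℝ => m (z.1 - z.2, z.2) * k (φ (z.1 - z.2, z.2)) *
      (hat f (z.1 - z.2) * hat g z.2) :=
    ((hm.comp hp).mul ((hk.comp hφ).comp hp)).mul (by fun_prop)
  exact (hmeas.stronglyMeasurable.integral_prod_right (ν := volume)).aestronglyMeasurable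

theorem enorm_bilinearHat_le {M K : ℝ≥0∞} {δ : ℝ} (hM : ∀ p, ‖m p‖ₑ ≤ M) (hK : ∀ y, ‖k y‖ₑ ≤ K)
    (hkδ : ∀ y, δ < |y| → k y = 0) (hS : MeasurableSet (resonantStrip φ (tsupport m) δ))
    (f g : L2) (ξ : ℝ) :
    ‖bilinearHat m φ k f g ξ‖ₑ ≤ M * K * truncatedConv (resonantStrip φ (tsupport m) δ)
      (fun ξ => ‖hat f ξ‖ₑ) (fun η => ‖hat g η‖ₑ) ξ := by
  have hf := (measurable_hat f).enorm
  have hg := (measurable_hat g).enorm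
  have hslice : MeasurableSet {η : ℝ | (ξ - η, η) ∈ resonantStrip φ (tsupport m) δ} :=
    (by fun_prop : Measurable fun η : ℝ => (ξ - η, η)) hS
  have hprod : Measurable fun η => ‖hat f (ξ - η)‖ₑ * ‖hat g η‖ₑ :=
    (hf.comp (measurable_const.sub measurable_id)).mul hg
  rw [truncatedConv, ← lintegral_const_mul _ hprod, ← lintegral_indicator hslice]
  refine (enorm_integral_le_lintegral_enorm _).trans (lintegral_mono fun η => ?_)
  by_cases hη : (ξ - η, η) ∈ resonantStrip φ (tsupport m) δ
  · rw [Set.indicator_of_mem (by exact hη), enorm_mul, enorm_mul, enorm_mul]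
    gcongr
    · exact hM _
    · exact hK _
  · rcases not_and_or.1 hη with hsupp | hphase
    · simp [image_eq_zero_of_notMem_tsupport hsupp]
    · simp [hkδ _ (not_le.1 hphase)]

theorem lintegral_bilinearHat_le {M K σ : ℝ≥0∞} {δ : ℝ} (hM : ∀ p, ‖m p‖ₑ ≤ M)
    (hK : ∀ y, ‖k y‖ₑ ≤ K) (hkδ : ∀ y, δ < |y| → k y = 0)
    (hS : HasThinSlices (resonantStrip φ (tsupport m) δ) σ) (f g : L2) :
    ∫⁻ ξ, ‖bilinearHat m φ k f g ξ‖ₑ ≤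
      M * K * (σ * (eLpNorm f 2 volume * eLpNorm g 2 volume)) := by
  refine (lintegral_mono
    (enorm_bilinearHat_le hM hK hkδ hS.measurableSet f g)).trans ?_
  rw [lintegral_const_mul _ (measurable_truncatedConv hS.measurableSet (measurable_hat f).enorm
    (measurable_hat g).enorm)]
  exact mul_le_mul' le_rfl (lintegral_truncatedConv_hat_le hS f g)

theorem eLpNorm_bilinearHat_le {M K X : ℝ≥0∞} {δ : ℝ} (hM : ∀ p, ‖m p‖ₑ ≤ M)
    (hK : ∀ y, ‖k y‖ₑ ≤ K) (hkδ : ∀ y, δ < |y| → k y = 0)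
    (hS : MeasurableSet (resonantStrip φ (tsupport m) δ)) {f g : L2}
    (hX : ∫⁻ ξ, truncatedConv (resonantStrip φ (tsupport m) δ) (fun ξ => ‖hat f ξ‖ₑ)
      (fun η => ‖hat g η‖ₑ) ξ ^ 2 ≤ X ^ 2) :
    eLpNorm (bilinearHat m φ k f g) 2 volume ≤ M * K * X := by
  have hsq : eLpNorm (bilinearHat m φ k f g) 2 volume ^ 2 =
    ∫⁻ ξ, ‖bilinearHat m φ k f g ξ‖ₑ ^ 2 := eLpNorm_pow_eq_lintegral _ two_ne_zero
  refine (ENNReal.pow_le_pow_left_iff two_ne_zero).1 ?_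
  rw [hsq, mul_pow]
  refine (lintegral_mono fun ξ =>
    pow_le_pow_left' (enorm_bilinearHat_le hM hK hkδ hS f g ξ) 2).trans ?_
  simp only [mul_pow _ (truncatedConv _ _ _ _)]
  rw [lintegral_const_mul _ ((measurable_truncatedConv hS (measurable_hat f).enorm
    (measurable_hat g).enorm).pow_const 2)]
  exact mul_le_mul' le_rfl hX

end DyadicPiece

/-! ### Dyadic decomposition of the phase -/

section Layers

variable {α β : Type*}

/-- The dyadic layers of a decreasing sequence `E` truncated at step `n`: the differences
`E j \ E (j + 1)` for `j < n`, the last layer `E n` being kept whole. -/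
def layer (E : ℕ → Set α) (n j : ℕ) : Set α :=
  if j < n then E j \ E (j + 1) else E j

theorem layer_subset (E : ℕ → Set α) (n j : ℕ) : layer E n j ⊆ E j := by
  rw [layer]
  split_ifs
  exacts [Set.sdiff_subset, subset_rfl]

theorem sum_indicator_layer [AddCommGroup β] {E : ℕ → Set α} (hE : Antitone E) (f : α → β) (n : ℕ) :
    ∑ j ∈ Finset.range (n + 1), (layer E n j).indicator f = (E 0).indicator f := by
  rw [← sum_indicator_diff_add_indicator hE f n, Finset.sum_range_succ]
  congr 1
  · exact Finset.sum_congr rfl fun j hj => by rw [layer, if_pos (Finset.mem_range.1 hj)]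
  · rw [layer, if_neg (lt_irrefl n)]

theorem measurableSet_layer [MeasurableSpace α] {E : ℕ → Set α} (hE : ∀ j, MeasurableSet (E j))
    (n j : ℕ) : MeasurableSet (layer E n j) := by
  rw [layer]
  split_ifs
  exacts [(hE j).diff (hE (j + 1)), hE j]

end Layers

section OscillatoryPieces

/-- The part of the oscillatory factor `oscIntegral t` living on the `j`-th dyadic layer
`|y| ∼ B / 2^j`, the last layer (`j = J`) being the whole interval `|y| ≤ B / 2^J`. -/
def oscPiece (B t : ℝ) (J j : ℕ) : ℝ → ℂ :=
  (layer (fun i => Metric.closedBall 0 (B / 2 ^ i)) J j).indicator (oscIntegral t)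

variable {B t : ℝ} {J : ℕ}

theorem measurable_oscPiece (B t : ℝ) (J j : ℕ) : Measurable (oscPiece B t J j) :=
  (continuous_oscIntegral t).measurable.indicator
    (measurableSet_layer (fun _ => measurableSet_closedBall) J j)

theorem oscPiece_eq_zero {j : ℕ} {y : ℝ} (hy : B / 2 ^ j < |y|) : oscPiece B t J j y = 0 :=
  Set.indicator_of_notMem (fun h => hy.not_ge (by simpa using layer_subset _ J j h)) _

theorem sum_oscPiece (hB : 0 ≤ B) {y : ℝ} (hy : |y| ≤ B) :
    ∑ j ∈ Finset.range (J + 1), oscPiece B t J j y = oscIntegral t y := by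
  have hanti : Antitone fun i : ℕ => Metric.closedBall (0 : ℝ) (B / 2 ^ i) := fun i j hij =>
    Metric.closedBall_subset_closedBall (by gcongr; exact one_le_two)
  have hsum := congrFun (sum_indicator_layer hanti (oscIntegral t) J) y
  rwa [Finset.sum_apply, Set.indicator_of_mem (by simpa using hy)] at hsum

theorem norm_oscPiece_le (hB : 1 ≤ B) (ht : 0 < t) (hJ : 2 ^ J ≤ max 1 t)
    (hJ' : max 1 t < 2 ^ (J + 1)) (j : ℕ) (y : ℝ) :
    ‖oscPiece B t J j y‖ ≤ 4 * min 1 t * 2 ^ j := by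
  by_cases hy : y ∈ layer (fun i => Metric.closedBall 0 (B / 2 ^ i)) J j
  swap
  · rw [oscPiece, Set.indicator_of_notMem hy, norm_zero]
    positivity
  rw [oscPiece, Set.indicator_of_mem hy]
  rw [layer] at hy
  split_ifs at hy with hj
  · have ht1 : 1 ≤ t := by
      have : (1 : ℝ) < 2 ^ J := one_lt_pow₀ one_lt_two (by lia)
      exact (lt_max_iff.1 (this.trans_le hJ)).resolve_left (lt_irrefl 1) |>.le
    have hlow : 1 / 2 ^ (j + 1) < |y| := by
      refine (div_le_div_of_nonneg_right hB (by positivity)).trans_lt ?_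
      simpa using hy.2
    have hy0 : 0 < |y| := lt_trans (by positivity) hlow
    rw [min_eq_left ht1]
    refine (norm_oscIntegral_le_div (abs_pos.1 hy0) t).trans ?_
    rw [div_lt_iff₀ (by positivity), pow_succ] at hlow
    rw [div_le_iff₀ hy0]
    linarith
  · calc ‖oscIntegral t y‖ ≤ t := norm_oscIntegral_le ht.le y
      _ = min 1 t * max 1 t := by rw [min_mul_max, one_mul]
      _ ≤ min 1 t * (2 * 2 ^ j) := by
          gcongr
          rw [← pow_succ']
          exact hJ'.le.trans (pow_le_pow_right₀ one_le_two (by lia))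
      _ ≤ 4 * min 1 t * 2 ^ j := by
          have : 0 ≤ min 1 t * 2 ^ j := by positivity
          linarith

end OscillatoryPieces

theorem eLpNorm_le_rpow_mul_of_eLpNorm_two_le {α E : Type*} [MeasurableSpace α]
    [NormedAddCommGroup E] {μ : Measure α} {f : α → E} (hf : AEStronglyMeasurable f μ)
    {q l X : ℝ≥0∞} (hq : 2 ≤ q) (h₂ : eLpNorm f 2 μ ≤ l * X) (htop : eLpNorm f ⊤ μ ≤ X) :
    eLpNorm f q μ ≤ l ^ (2 / q).toReal * X := by
  have hθ : (2 / q).toReal ≤ 1 := by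
    refine (ENNReal.toReal_mono ENNReal.one_ne_top ?_).trans_eq ENNReal.toReal_one
    exact ENNReal.div_le_of_le_mul (by rwa [one_mul])
  have hθ' : 0 ≤ 1 - (2 / q).toReal := sub_nonneg.2 hθ
  calc eLpNorm f q μ ≤ eLpNorm f 2 μ ^ (2 / q).toReal * eLpNorm f ⊤ μ ^ (1 - (2 / q).toReal) :=
        eLpNorm_le_eLpNorm_rpow_mul_eLpNorm_top_rpow hf two_ne_zero ENNReal.ofNat_ne_top hq
    _ ≤ (l * X) ^ (2 / q).toReal * X ^ (1 - (2 / q).toReal) := by gcongr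
    _ = l ^ (2 / q).toReal * X := by
        rw [ENNReal.mul_rpow_of_nonneg _ _ ENNReal.toReal_nonneg, mul_assoc,
          ← ENNReal.rpow_add_of_nonneg _ _ ENNReal.toReal_nonneg hθ', add_sub_cancel,
          ENNReal.rpow_one]

theorem exists_hat_eq_mul_of_lintegral_le {V θ : ℝ → ℂ} (hV : MemLp V 2 volume)
    (hθ : Measurable θ) (hθ1 : ∀ ξ, ‖θ ξ‖ = 1) {q l X : ℝ≥0∞} (hq : 2 ≤ q)
    (h₂ : eLpNorm V 2 volume ≤ l * X) (h₁ : ∫⁻ ξ, ‖V ξ‖ₑ ≤ X) :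
    ∃ y : L2, hat y =ᵐ[volume] (fun ξ => θ ξ * V ξ) ∧
      eLpNorm y q volume ≤ l ^ (2 / q).toReal * X := by
  have hnorm (ξ : ℝ) : ‖θ ξ * V ξ‖ = ‖V ξ‖ := by rw [norm_mul, hθ1, one_mul]
  have hU : MemLp (fun ξ => θ ξ * V ξ) 2 volume :=
    hV.congr_norm (hθ.aestronglyMeasurable.mul hV.1) (.of_forall fun ξ => (hnorm ξ).symm)
  obtain ⟨y, hy, hytop⟩ := exists_hat_eq hU
  refine ⟨y, hy, eLpNorm_le_rpow_mul_of_eLpNorm_two_le (Lp.aestronglyMeasurable y) hq ?_ ?_⟩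
  · rwa [← eLpNorm_hat, eLpNorm_congr_ae hy, eLpNorm_congr_norm_ae (.of_forall hnorm)]
  · refine (hytop.trans_eq (lintegral_congr fun ξ => ?_)).trans h₁
    rw [← ofReal_norm, hnorm, ofReal_norm]

/-- A multiplier, to be evaluated at the phase, that lives on the dyadic scale `|y| ≤ B / 2 ^ n`
and is at most as large as `A 2 ^ n`, the reciprocal of that scale up to a constant. -/
structure IsDyadicMultiplier (B : ℝ) (A : ℝ≥0) (n : ℕ) (k : ℝ → ℂ) : Prop where
  measurable : Measurable k
  enorm_le (y : ℝ) : ‖k y‖ₑ ≤ A * 2 ^ n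
  eq_zero (y : ℝ) : B / 2 ^ n < |y| → k y = 0

theorem isDyadicMultiplier_oscPiece {B t : ℝ} {J : ℕ} (hB : 1 ≤ B) (ht : 0 < t)
    (hJ : 2 ^ J ≤ max 1 t) (hJ' : max 1 t < 2 ^ (J + 1)) (j : ℕ) :
    IsDyadicMultiplier B (4 * min 1 t).toNNReal j (oscPiece B t J j) where
  measurable := measurable_oscPiece B t J j
  enorm_le y := by
    rw [← ofReal_norm, ENNReal.ofNNReal_toNNReal, ← ENNReal.ofReal_ofNat 2,
      ← ENNReal.ofReal_pow zero_le_two, ← ENNReal.ofReal_mul (by positivity)]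
    exact ENNReal.ofReal_le_ofReal (norm_oscPiece_le hB ht hJ hJ' j y)
  eq_zero _ := oscPiece_eq_zero

section DyadicScale

variable {m : ℝ × ℝ → ℂ} {φ : ℝ × ℝ → ℝ} {k : ℝ → ℂ} {A M σ : ℝ≥0} {B s : ℝ} {n : ℕ}

theorem IsDyadicMultiplier.lintegral_enorm_bilinearHat_le (hk : IsDyadicMultiplier B A n k)
    (hM : ∀ p, ‖m p‖ₑ ≤ M)
    (hS : HasThinSlices (resonantStrip φ (tsupport m) (B / 2 ^ n)) (σ / 2 ^ n)) (f g : L2) :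
    ∫⁻ ξ, ‖bilinearHat m φ k f g ξ‖ₑ ≤
      M * A * σ * (eLpNorm f 2 volume * eLpNorm g 2 volume) := by
  refine (lintegral_bilinearHat_le hM hk.enorm_le hk.eq_zero hS f g).trans_eq ?_
  calc M * (A * 2 ^ n) * (σ / 2 ^ n * (eLpNorm f 2 volume * eLpNorm g 2 volume))
      = M * A * (σ / 2 ^ n * 2 ^ n) * (eLpNorm f 2 volume * eLpNorm g 2 volume) := by ring
    _ = _ := by rw [ENNReal.div_mul_cancel (by simp) (by simp)]

theorem exists_eLpNorm_bilinearHat_le (hM : ∀ p, ‖m p‖ₑ ≤ M)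
    (hS : ∀ n : ℕ, HasThinSlices (resonantStrip φ (tsupport m) (B / 2 ^ n)) (σ / 2 ^ n))
    (hs : 0 ≤ s) (hs4 : s ≠ 1 / 4) :
    ∃ C : ℝ≥0, ∀ (n : ℕ) (A : ℝ≥0) (k : ℝ → ℂ), IsDyadicMultiplier B A n k → ∀ f g : L2,
      eLpNorm (bilinearHat m φ k f g) 2 volume ≤
        C * A * 2 ^ (2 * growthExponent s * n) * (weightedNorm s f * weightedNorm s g) := by
  obtain ⟨C, hC⟩ := exists_lintegral_sq_truncatedConv_hat_le hs hs4 σ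
  refine ⟨M * C, fun n A k hk f g => (eLpNorm_bilinearHat_le hM hk.enorm_le hk.eq_zero
    (hS n).measurableSet (hC n _ (hS n) f g)).trans_eq ?_⟩
  set P : ℝ≥0∞ := 2 ^ (2 * growthExponent s * n)
  calc M * (A * 2 ^ n) * (C * P / 2 ^ n * (weightedNorm s f * weightedNorm s g))
      = M * A * (C * P / 2 ^ n * 2 ^ n) * (weightedNorm s f * weightedNorm s g) := by ring
    _ = M * A * (C * P) * (weightedNorm s f * weightedNorm s g) := by
        rw [ENNReal.div_mul_cancel (by simp) (by simp)]
    _ = _ := by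
        push_cast
        ring

theorem IsDyadicMultiplier.memLp_bilinearHat (hk : IsDyadicMultiplier B A n k) (hm : Measurable m)
    (hφ : Measurable φ) (hM : ∀ p, ‖m p‖ₑ ≤ M)
    (hS : ∀ n : ℕ, HasThinSlices (resonantStrip φ (tsupport m) (B / 2 ^ n)) (σ / 2 ^ n))
    (f g : L2) : MemLp (bilinearHat m φ k f g) 2 volume := by
  obtain ⟨C, hC⟩ := exists_eLpNorm_bilinearHat_le hM hS (le_refl 0) (by norm_num)
  refine ⟨aestronglyMeasurable_bilinearHat hm hφ hk.measurable f g, (hC n A k hk f g).trans_lt ?_⟩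
  rw [weightedNorm_zero, weightedNorm_zero]
  exact ENNReal.mul_lt_top
    (ENNReal.mul_lt_top (by finiteness) (ENNReal.rpow_lt_top_of_nonneg
      (by have := growthExponent_nonneg 0; positivity) ENNReal.ofNat_ne_top))
    (ENNReal.mul_lt_top (Lp.eLpNorm_lt_top f) (Lp.eLpNorm_lt_top g))

theorem exists_hat_eq_mul_bilinearHat (hm : Measurable m) (hφ : Measurable φ)
    (hM : ∀ p, ‖m p‖ₑ ≤ M)
    (hS : ∀ n : ℕ, HasThinSlices (resonantStrip φ (tsupport m) (B / 2 ^ n)) (σ / 2 ^ n))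
    (hs : 0 ≤ s) (hs4 : s ≠ 1 / 4) {q : ℝ≥0∞} (hq : 2 ≤ q) :
    ∃ C : ℝ≥0, ∀ (n : ℕ) (A : ℝ≥0) (k θ : ℝ → ℂ), IsDyadicMultiplier B A n k →
      Measurable θ → (∀ ξ, ‖θ ξ‖ = 1) → ∀ f g : L2,
      ∃ y : L2, hat y =ᵐ[volume] (fun ξ => θ ξ * bilinearHat m φ k f g ξ) ∧
        eLpNorm y q volume ≤ C * A * 2 ^ (2 * growthExponent s * (2 / q).toReal * n) *
          (weightedNorm s f * weightedNorm s g) := by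
  obtain ⟨C, hC⟩ := exists_eLpNorm_bilinearHat_le hM hS hs hs4
  refine ⟨C + M * σ, fun n A k θ hk hθ hθ1 f g => ?_⟩
  set W := weightedNorm s f * weightedNorm s g
  set X : ℝ≥0∞ := (C + M * σ : ℝ≥0) * A * W with hX
  have h₂ : eLpNorm (bilinearHat m φ k f g) 2 volume ≤ 2 ^ (2 * growthExponent s * n) * X := by
    calc eLpNorm (bilinearHat m φ k f g) 2 volume
        ≤ C * A * 2 ^ (2 * growthExponent s * n) * W := hC n A k hk f g
      _ = 2 ^ (2 * growthExponent s * n) * (C * A * W) := by ring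
      _ ≤ 2 ^ (2 * growthExponent s * n) * X := by
          rw [hX, ENNReal.coe_add]
          gcongr
          exact le_self_add
  have h₁ : ∫⁻ ξ, ‖bilinearHat m φ k f g ξ‖ₑ ≤ X := by
    calc ∫⁻ ξ, ‖bilinearHat m φ k f g ξ‖ₑ
        ≤ M * A * σ * (eLpNorm f 2 volume * eLpNorm g 2 volume) :=
          hk.lintegral_enorm_bilinearHat_le hM (hS n) f g
      _ ≤ M * A * σ * W := mul_le_mul' le_rfl
          (mul_le_mul' (eLpNorm_le_weightedNorm f hs) (eLpNorm_le_weightedNorm g hs))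
      _ = (M * σ : ℝ≥0) * A * W := by
          push_cast
          ring
      _ ≤ X := by
          rw [hX, ENNReal.coe_add]
          gcongr
          exact le_add_self
  obtain ⟨y, hy, hyq⟩ := exists_hat_eq_mul_of_lintegral_le
    (hk.memLp_bilinearHat hm hφ hM hS f g) hθ hθ1 hq h₂ h₁
  refine ⟨y, hy, hyq.trans_eq ?_⟩
  rw [← ENNReal.rpow_mul, hX, mul_right_comm _ (n : ℝ)]
  ring

theorem bilinearHat_eq_sum {ι : Type*} {I : Finset ι} {k' : ι → ℝ → ℂ} {M : ℝ}
    (hm : Measurable m) (hφ : Measurable φ) (hM : ∀ p, ‖m p‖ ≤ M)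
    (hk' : ∀ i ∈ I, Measurable (k' i)) (hbdd : ∀ i ∈ I, ∃ K, ∀ y, ‖k' i y‖ ≤ K)
    (hsum : ∀ p ∈ tsupport m, k (φ p) = ∑ i ∈ I, k' i (φ p)) (f g : L2) (ξ : ℝ) :
    bilinearHat m φ k f g ξ = ∑ i ∈ I, bilinearHat m φ (k' i) f g ξ := by
  simp only [bilinearHat]
  rw [← integral_finsetSum]
  · refine integral_congr_ae (.of_forall fun η => ?_)
    by_cases hη : (ξ - η, η) ∈ tsupport m
    · simp only [hsum _ hη, Finset.mul_sum, Finset.sum_mul]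
    · simp [image_eq_zero_of_notMem_tsupport hη]
  · intro i hi
    obtain ⟨K, hK⟩ := hbdd i hi
    have hp : Measurable fun η : ℝ => (ξ - η, η) := by fun_prop
    refine (integrable_hat_mul_hat f g ξ).bdd_mul (c := M * K)
      ((hm.comp hp).mul ((hk' i hi).comp (hφ.comp hp))).aestronglyMeasurable
      (.of_forall fun η => ?_)
    rw [norm_mul]
    exact mul_le_mul (hM _) (hK _) (norm_nonneg _) ((norm_nonneg _).trans (hM (ξ - η, η)))

end DyadicScale

/-! ### Bounds for the solution -/

section Solution

variable {a b c : ℝ → ℝ} {m : ℝ × ℝ → ℂ} {M s : ℝ} {q : ℝ≥0∞}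

theorem contDiff_phase {n : ℕ∞} (ha : ContDiff ℝ n a) (hb : ContDiff ℝ n b) (hc : ContDiff ℝ n c) :
    ContDiff ℝ n (phase a b c) :=
  ((ha.comp (contDiff_fst.add contDiff_snd)).neg.add (hb.comp contDiff_fst)).add
    (hc.comp contDiff_snd)

theorem exists_hasThinSlices_resonantStrip_div_two_pow {φ : ℝ × ℝ → ℝ} (hφ : ContDiff ℝ 1 φ)
    {K : Set (ℝ × ℝ)} (hK : IsCompact K) (hΓ : NonCharacteristicOn φ K) :
    ∃ (B : ℝ) (σ : ℝ≥0), 1 ≤ B ∧ (∀ p ∈ K, |φ p| ≤ B) ∧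
      ∀ n : ℕ, HasThinSlices (resonantStrip φ K (B / 2 ^ n)) (σ / 2 ^ n) := by
  obtain ⟨B, hB⟩ := hK.exists_bound_of_continuousOn hφ.continuous.continuousOn
  obtain ⟨D, hD⟩ := exists_hasThinSlices_resonantStrip hφ hK hΓ
  refine ⟨max 1 B, D * (max 1 B).toNNReal, le_max_left _ _,
    fun p hp => (hB p hp).trans (le_max_right _ _), fun n => ?_⟩
  convert hD (max 1 B / 2 ^ n) using 1
  rw [ENNReal.ofReal_div_of_pos (by positivity), ENNReal.ofReal_pow zero_le_two,
    ENNReal.ofReal_ofNat, ENNReal.coe_mul, ← mul_div_assoc, ENNReal.ofReal]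

theorem eLpNorm_sum_coeFn_le {ι : Type*} (hq : 1 ≤ q) (I : Finset ι) (y : ι → L2) :
    eLpNorm (∑ i ∈ I, y i : L2) q volume ≤ ∑ i ∈ I, eLpNorm (y i) q volume :=
  (eLpNorm_congr_ae (Lp.coeFn_finsetSum I y)).trans_le
    (eLpNorm_sum_le (fun i _ => Lp.aestronglyMeasurable (y i)) hq)

theorem exists_eLpNorm_le_sum (ha : ContDiff ℝ 1 a) (hb : ContDiff ℝ 1 b) (hc : ContDiff ℝ 1 c)
    (hm : Measurable m) (hM : ∀ p, ‖m p‖ ≤ M) (hm_supp : HasCompactSupport m)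
    (hΓ : NonCharacteristicOn (phase a b c) (tsupport m)) (hs : 0 ≤ s) (hs4 : s ≠ 1 / 4)
    (hq : 2 ≤ q) :
    ∃ C : ℝ≥0, ∀ (f g : L2) (u v w : ℝ → L2), IsSolution a b c m f g u v w →
      ∀ t : ℝ, 0 < t → ∀ J : ℕ, 2 ^ J ≤ max 1 t → max 1 t < 2 ^ (J + 1) →
        eLpNorm (u t) q volume ≤ C * (ENNReal.ofReal (min 1 t) *
          ∑ j ∈ Finset.range (J + 1), 2 ^ (2 * growthExponent s * (2 / q).toReal * j)) *
            (weightedNorm s f * weightedNorm s g) := by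
  have hφ : ContDiff ℝ 1 (phase a b c) := contDiff_phase ha hb hc
  have hφm : Measurable (phase a b c) := hφ.continuous.measurable
  obtain ⟨B, σ, hB1, hB, hS⟩ := exists_hasThinSlices_resonantStrip_div_two_pow hφ hm_supp hΓ
  have hM' (p : ℝ × ℝ) : ‖m p‖ₑ ≤ M.toNNReal := by
    rw [← ofReal_norm]
    exact ENNReal.ofReal_le_ofReal (hM p)
  obtain ⟨C, hC⟩ := exists_hat_eq_mul_bilinearHat hm hφm hM' hS hs hs4 hq
  refine ⟨C * 4, fun f g u v w hu t ht J hJ hJ' => ?_⟩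
  have hk := isDyadicMultiplier_oscPiece hB1 ht hJ hJ'
  have hθ : Measurable fun ξ => cexp (I * t * a ξ) * -I :=
    (measurable_const.mul (measurable_ofReal.comp ha.continuous.measurable)).cexp.mul_const _
  choose y hy hyq using fun j => hC j _ _ _ (hk j) hθ
    (fun ξ => by rw [norm_mul, norm_cexp_I_mul_mul, norm_neg, norm_I, mul_one]) f g
  have hsum : u t = ∑ j ∈ Finset.range (J + 1), y j := by
    refine hat_injective ?_
    filter_upwards [hat_eq_of_isSolution hb.continuous.measurable hc.continuous.measurable hm hM hu
      ht.le, hat_sum (Finset.range (J + 1)) y, ae_all_iff.2 hy] with ξ huξ hsumξ hyξ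
    rw [huξ, hsumξ, bilinearHat_eq_sum hm hφm hM (fun j _ => (hk j).measurable)
      (fun j _ => ⟨_, norm_oscPiece_le hB1 ht hJ hJ' j⟩)
      fun p hp => (sum_oscPiece (zero_le_one.trans hB1) (hB p hp)).symm]
    simp only [hyξ, Finset.mul_sum, mul_assoc]
  rw [hsum]
  refine (eLpNorm_sum_coeFn_le (one_le_two.trans hq) _ y).trans
    ((Finset.sum_le_sum fun j _ => hyq j).trans_eq ?_)
  have h4 : ((4 * min 1 t).toNNReal : ℝ≥0∞) = 4 * ENNReal.ofReal (min 1 t) := by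
    rw [ENNReal.ofNNReal_toNNReal, ENNReal.ofReal_mul zero_le_four, ENNReal.ofReal_ofNat]
  rw [h4, ← Finset.sum_mul, ← Finset.mul_sum]
  push_cast
  ring

end Solution

section TimeGrowth

theorem min_mul_max_rpow_le {t e : ℝ} (ht : 0 < t) (he : e ≤ 1) :
    min 1 t * max 1 t ^ e ≤ t ^ e := by
  rcases le_total t 1 with h | h
  · rw [min_eq_right h, max_eq_left h, Real.one_rpow, mul_one]
    simpa using Real.rpow_le_rpow_of_exponent_ge ht h he
  · rw [min_eq_left h, max_eq_right h, one_mul]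

theorem natCast_mul_log_two_le {J : ℕ} {t : ℝ} (hJ : 2 ^ J ≤ max 1 t) :
    J * Real.log 2 ≤ |Real.log t| := by
  rw [← Real.log_pow]
  rcases le_max_iff.1 hJ with h | h
  · exact (Real.log_nonpos (by positivity) h).trans (abs_nonneg _)
  · exact (Real.log_le_log (by positivity) h).trans (le_abs_self _)

theorem natCast_add_one_le_jap_log {J : ℕ} {t : ℝ} (hJ : 2 ^ J ≤ max 1 t) :
    (J + 1 : ℝ) ≤ 3 * jap (Real.log t) := by
  have hlog := natCast_mul_log_two_le hJ
  nlinarith [one_le_jap (Real.log t), abs_le_jap (Real.log t), Real.log_two_gt_d9,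
    (Nat.cast_nonneg J : (0 : ℝ) ≤ J)]

theorem exists_min_mul_sum_two_rpow_le {e : ℝ} (he0 : 0 < e) (he1 : e ≤ 1) :
    ∃ C : ℝ≥0, ∀ t : ℝ, 0 < t → ∀ J : ℕ, 2 ^ J ≤ max 1 t →
      ENNReal.ofReal (min 1 t) * ∑ j ∈ Finset.range (J + 1), (2 : ℝ≥0∞) ^ (e * j) ≤
        C * ENNReal.ofReal (t ^ e) := by
  obtain ⟨C, hC⟩ := exists_sum_two_rpow_le he0.ne'
  refine ⟨C * (2 ^ e : ℝ).toNNReal, fun t ht J hJ => ?_⟩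
  have hmin : 0 < min 1 t := lt_min one_pos ht
  have hpow : (2 : ℝ) ^ (e * ↑(J + 1)) ≤ 2 ^ e * max 1 t ^ e := by
    rw [Nat.cast_add_one, mul_add_one, add_comm, Real.rpow_add two_pos, mul_comm e,
      Real.rpow_mul zero_le_two, Real.rpow_natCast]
    gcongr
  calc ENNReal.ofReal (min 1 t) * ∑ j ∈ Finset.range (J + 1), (2 : ℝ≥0∞) ^ (e * j)
      ≤ ENNReal.ofReal (min 1 t) * (C * ENNReal.ofReal (2 ^ e * max 1 t ^ e)) := by
        gcongr
        refine (hC (J + 1)).trans ?_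
        rw [max_eq_left he0.le, ← ofReal_two_rpow]
        gcongr
    _ = C * ENNReal.ofReal (2 ^ e) * ENNReal.ofReal (min 1 t * max 1 t ^ e) := by
        rw [ENNReal.ofReal_mul (by positivity), ENNReal.ofReal_mul hmin.le]
        ring
    _ ≤ C * ENNReal.ofReal (2 ^ e) * ENNReal.ofReal (t ^ e) := by
        gcongr
        exact min_mul_max_rpow_le ht he1
    _ = _ := by rw [ENNReal.coe_mul, ENNReal.ofNNReal_toNNReal]

theorem min_mul_sum_two_rpow_zero_le {t : ℝ} {J : ℕ} (hJ : 2 ^ J ≤ max 1 t) :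
    ENNReal.ofReal (min 1 t) * ∑ j ∈ Finset.range (J + 1), (2 : ℝ≥0∞) ^ ((0 : ℝ) * j) ≤
      (3 : ℝ≥0) * ENNReal.ofReal (jap (Real.log t)) := by
  calc ENNReal.ofReal (min 1 t) * ∑ j ∈ Finset.range (J + 1), (2 : ℝ≥0∞) ^ ((0 : ℝ) * j)
      ≤ 1 * ENNReal.ofReal (J + 1) := by
        gcongr
        · exact ENNReal.ofReal_le_one.2 (min_le_left 1 t)
        · simp [ENNReal.ofReal_add]
    _ ≤ ENNReal.ofReal (3 * jap (Real.log t)) := by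
        rw [one_mul]
        exact ENNReal.ofReal_le_ofReal (natCast_add_one_le_jap_log hJ)
    _ = _ := by rw [ENNReal.ofReal_mul zero_le_three, ENNReal.ofReal_ofNat, ENNReal.coe_ofNat]

end TimeGrowth

section Bounds

variable {a b c : ℝ → ℝ} {m : ℝ × ℝ → ℂ} {M s q : ℝ}

theorem exists_eLpNorm_le_of_growth (ha : ContDiff ℝ 1 a) (hb : ContDiff ℝ 1 b)
    (hc : ContDiff ℝ 1 c) (hm : Measurable m) (hM : ∀ p, ‖m p‖ ≤ M) (hm_supp : HasCompactSupport m)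
    (hΓ : NonCharacteristicOn (phase a b c) (tsupport m)) (hs : 0 ≤ s) (hs4 : s ≠ 1 / 4)
    {q : ℝ≥0∞} (hq : 2 ≤ q) {G : ℝ → ℝ} {e : ℝ} (he : 2 * growthExponent s * (2 / q).toReal = e)
    (hG : ∃ C : ℝ≥0, ∀ t : ℝ, 0 < t → ∀ J : ℕ, 2 ^ J ≤ max 1 t →
      ENNReal.ofReal (min 1 t) * ∑ j ∈ Finset.range (J + 1), (2 : ℝ≥0∞) ^ (e * j) ≤
        C * ENNReal.ofReal (G t)) :
    ∃ C : ℝ, 0 < C ∧ ∀ (f g : L2) (u v w : ℝ → L2), IsSolution a b c m f g u v w →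
      ∀ t : ℝ, 0 < t →
        eLpNorm (u t) q volume ≤
          ENNReal.ofReal (C * G t) * weightedNorm s f * weightedNorm s g := by
  obtain ⟨C₁, hC₁⟩ := hG
  obtain ⟨C₂, hC₂⟩ := exists_eLpNorm_le_sum ha hb hc hm hM hm_supp hΓ hs hs4 hq
  refine ⟨C₂ * C₁ + 1, by positivity, fun f g u v w hu t ht => ?_⟩
  obtain ⟨J, hJ, hJ'⟩ := exists_nat_pow_near (le_max_left 1 t) one_lt_two
  subst he
  calc eLpNorm (u t) q volume
      ≤ C₂ * (C₁ * ENNReal.ofReal (G t)) * (weightedNorm s f * weightedNorm s g) := by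
        refine (hC₂ f g u v w hu t ht J hJ hJ').trans ?_
        exact mul_le_mul' (mul_le_mul' le_rfl (hC₁ t ht J hJ)) le_rfl
    _ = ENNReal.ofReal (C₂ * C₁) * ENNReal.ofReal (G t) * weightedNorm s f * weightedNorm s g := by
        rw [← NNReal.coe_mul, ENNReal.ofReal_coe_nnreal, ENNReal.coe_mul]
        ring
    _ ≤ _ := by
        rw [ENNReal.ofReal_mul (by positivity : (0 : ℝ) ≤ C₂ * C₁ + 1)]
        gcongr
        linarith

theorem two_mul_mul_toReal_two_div_ofReal (κ : ℝ) (hq : 0 < q) :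
    2 * κ * (2 / ENNReal.ofReal q).toReal = 4 * κ / q := by
  rw [ENNReal.toReal_div, ENNReal.toReal_ofNat, ENNReal.toReal_ofReal hq.le]
  ring

variable (ha : ContDiff ℝ 1 a) (hb : ContDiff ℝ 1 b) (hc : ContDiff ℝ 1 c) (hm : Measurable m)
  (hM : ∀ p, ‖m p‖ ≤ M) (hm_supp : HasCompactSupport m)
  (hΓ : NonCharacteristicOn (phase a b c) (tsupport m))

include ha hb hc hm hM hm_supp hΓ

theorem exists_eLpNorm_le_rpow (hq : 2 ≤ q) (hs : 0 ≤ s) (hs4 : s < 1 / 4) :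
    ∃ C : ℝ, 0 < C ∧ ∀ (f g : L2) (u v w : ℝ → L2), IsSolution a b c m f g u v w →
      ∀ t : ℝ, 0 < t →
        eLpNorm (u t) (ENNReal.ofReal q) volume ≤
          ENNReal.ofReal (C * t ^ ((1 - 4 * s) / q)) * weightedNorm s f * weightedNorm s g := by
  have hq0 : 0 < q := two_pos.trans_le hq
  refine exists_eLpNorm_le_of_growth ha hb hc hm hM hm_supp hΓ hs hs4.ne
    (by simpa using ENNReal.ofReal_le_ofReal hq) ?_ (exists_min_mul_sum_two_rpow_le
      (div_pos (by linarith) hq0) ((div_le_one hq0).2 (by linarith)))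
  rw [two_mul_mul_toReal_two_div_ofReal _ hq0, growthExponent_of_lt hs4]
  ring

theorem exists_eLpNorm_le_jap_log (hq : 2 ≤ q) (hs4 : 1 / 4 < s) :
    ∃ C : ℝ, 0 < C ∧ ∀ (f g : L2) (u v w : ℝ → L2), IsSolution a b c m f g u v w →
      ∀ t : ℝ, 0 < t →
        eLpNorm (u t) (ENNReal.ofReal q) volume ≤
          ENNReal.ofReal (C * jap (Real.log t)) * weightedNorm s f * weightedNorm s g :=
  exists_eLpNorm_le_of_growth ha hb hc hm hM hm_supp hΓ (by linarith) hs4.ne'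
    (by simpa using ENNReal.ofReal_le_ofReal hq)
    (by rw [growthExponent_of_gt hs4, mul_zero, zero_mul])
    ⟨3, fun _ _ _ => min_mul_sum_two_rpow_zero_le⟩

theorem exists_eLpNorm_top_le_jap_log :
    ∃ C : ℝ, 0 < C ∧ ∀ (f g : L2) (u v w : ℝ → L2), IsSolution a b c m f g u v w →
      ∀ t : ℝ, 0 < t →
        eLpNorm (u t) ⊤ volume ≤
          ENNReal.ofReal (C * jap (Real.log t)) * eLpNorm f 2 volume * eLpNorm g 2 volume := by
  simpa only [weightedNorm_zero] using
    exists_eLpNorm_le_of_growth ha hb hc hm hM hm_supp hΓ le_rfl (by norm_num) le_top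
      (e := 0) (by simp) ⟨3, fun _ _ _ => min_mul_sum_two_rpow_zero_le⟩

end Bounds

theorem theorem4p2_general (a b c : ℝ → ℝ) (m : ℝ × ℝ → ℂ) (M : ℝ)
    (ha : ContDiff ℝ 1 a) (hb : ContDiff ℝ 1 b) (hc : ContDiff ℝ 1 c)
    (hm : Measurable m) (hM : ∀ p, ‖m p‖ ≤ M) (hm_supp : HasCompactSupport m)
    (hΓ : NonCharacteristicOn (phase a b c) (tsupport m)) :
    (∀ q s : ℝ, 2 ≤ q → 0 ≤ s → s < 1 / 4 →
      ∃ C : ℝ, 0 < C ∧ ∀ (f g : L2) (u v w : ℝ → L2), IsSolution a b c m f g u v w →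
        ∀ t : ℝ, 0 < t →
          eLpNorm (u t) (ENNReal.ofReal q) volume ≤
            ENNReal.ofReal (C * t ^ ((1 - 4 * s) / q)) * weightedNorm s f * weightedNorm s g) ∧
    (∀ q s : ℝ, 2 ≤ q → 1 / 4 < s →
      ∃ C : ℝ, 0 < C ∧ ∀ (f g : L2) (u v w : ℝ → L2), IsSolution a b c m f g u v w →
        ∀ t : ℝ, 0 < t →
          eLpNorm (u t) (ENNReal.ofReal q) volume ≤
            ENNReal.ofReal (C * jap (Real.log t)) * weightedNorm s f * weightedNorm s g) ∧
    (∃ C : ℝ, 0 < C ∧ ∀ (f g : L2) (u v w : ℝ → L2), IsSolution a b c m f g u v w →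
        ∀ t : ℝ, 0 < t →
          eLpNorm (u t) ⊤ volume ≤
            ENNReal.ofReal (C * jap (Real.log t)) *
              eLpNorm f 2 volume * eLpNorm g 2 volume) :=
  ⟨fun _ _ hq hs hs4 => exists_eLpNorm_le_rpow ha hb hc hm hM hm_supp hΓ hq hs hs4,
    fun _ _ hq hs4 => exists_eLpNorm_le_jap_log ha hb hc hm hM hm_supp hΓ hq hs4,
    exists_eLpNorm_top_le_jap_log ha hb hc hm hM hm_supp hΓ⟩

end

theorem theorem4p2 (a b c : ℝ → ℝ) (m : ℝ × ℝ → ℂ)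
    (ha : ContDiff ℝ ∞ a) (hb : ContDiff ℝ ∞ b) (hc : ContDiff ℝ ∞ c)
    (hm : ContDiff ℝ ∞ m) (hm_supp : HasCompactSupport m)
    (hφ : VanishesToFirstOrderOn (phase a b c) (tsupport m))
    (hΓ : NonCharacteristicOn (phase a b c) (tsupport m)) :
    (∀ q s : ℝ, 2 ≤ q → 0 ≤ s → s < 1 / 4 →
      ∃ C : ℝ, 0 < C ∧ ∀ (f g : L2) (u v w : ℝ → L2), IsSolution a b c m f g u v w →
        ∀ t : ℝ, 0 < t →
          eLpNorm (u t) (ENNReal.ofReal q) volume ≤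
            ENNReal.ofReal (C * t ^ ((1 - 4 * s) / q)) * weightedNorm s f * weightedNorm s g) ∧
    (∀ q s : ℝ, 2 ≤ q → 1 / 4 < s →
      ∃ C : ℝ, 0 < C ∧ ∀ (f g : L2) (u v w : ℝ → L2), IsSolution a b c m f g u v w →
        ∀ t : ℝ, 0 < t →
          eLpNorm (u t) (ENNReal.ofReal q) volume ≤
            ENNReal.ofReal (C * jap (Real.log t)) * weightedNorm s f * weightedNorm s g) ∧
    (∃ C : ℝ, 0 < C ∧ ∀ (f g : L2) (u v w : ℝ → L2), IsSolution a b c m f g u v w →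
        ∀ t : ℝ, 0 < t →
          eLpNorm (u t) ⊤ volume ≤
            ENNReal.ofReal (C * jap (Real.log t)) *
              eLpNorm f 2 volume * eLpNorm g 2 volume) := by
  obtain ⟨M, hM⟩ := hm_supp.exists_bound_of_continuous hm.continuous
  exact theorem4p2_general a b c m M (ha.of_le (mod_cast le_top)) (hb.of_le (mod_cast le_top))
    (hc.of_le (mod_cast le_top)) hm.continuous.measurable hM hm_supp hΓ
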